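/- Let $t_0>0$, $\alpha>0$, $K>0$, and let $p,q\in C^3([t_0,\infty))$ be real functions with $p(t)\neq0$ and $q'(t)\neq0$ for all $t\ge t_0$. Suppose that, as $t\to\infty$, $$p(t)\sim t^{-\alpha},\quad p'(t)\sim-\alpha t^{-\alpha-1},\quad p''(t)\sim\alpha(\alpha+1)t^{-\alpha-2},\quad p'''(t)=O(t^{-\alpha-3}),$$ $$q(t)\sim Kt,\quad q'(t)\sim K,\quad q''(t)=o(t^{-3}),\quad q'''(t)=o(t^{-2}),$$ where $f\sim g$ means $f(t)/g(t)\to1$. Put $$a=\frac{2p'}{p}+\frac{q''}{q'},\qquad b=q'^2+\frac{2p'^2}{p^2}-\frac{p''}{p}+\frac{p'q''}{pq'},$$ and consider the equation $$\ddot x-a(t)\,\dot x+b(t)\,x=0,\qquad t\in[t_0,\infty),\tag{1}$$ and, for $\gamma>0$, $\delta=(\gamma+1)/\gamma$ and $z_0=(\gamma/t_0)^{\gamma}$, the system $$\dot x=y,\qquad \dot y=-b(\gamma z^{-1/\gamma})\,x+a(\gamma z^{-1/\gamma})\,y,\qquad \dot z=-z^{\delta},\qquad z\in(0,z_0].\tag{2}$$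 A trajectory of (2) is a set $\Gamma=\{(x(s),y(s),z(s)):s\ge s_0\}\subset\mathbb R^3$, where $s_0\in\mathbb R$ and $(x,y,z)$ solves (2) on $[s_0,\infty)$; it is called nontrivial if $(x,y)$ is not identically $(0,0)$. A spiral is a set given in polar coordinates by $r=f(\varphi)$, $\varphi\ge\varphi_1>0$, where $f>0$, $f(\varphi)\to0$ as $\varphi\to\infty$, and $k\mapsto f(\varphi+2k\pi)$, $k\in\mathbb N$, is decreasing for each $\varphi\ge\varphi_1$, or the mirror image of such a set in the $x$-axis. For bounded $A\subset\mathbb R^N$ with open $\varepsilon$-neighbourhood $A_\varepsilon$, the lower and upper box dimensions are the infima of those $s\ge0$ for which the lower, respectively upper, limit of $|A_\varepsilon|/\varepsilon^{N-s}$ as $\varepsilon\to0^+$ is $0$; $\dim_BA$ is their common value. Then: (i) For every solution $x\not\equiv0$ of (1) the phase portrait $\{(x(t),\dot x(t)):t\ge t_0\}$ is a spiral near the origin, that is, $\{(x(t),\dot x(t)):t\ge t_1\}$ is a spiral for some $t_1\ge t_0$. If $\alpha\in(0,1)$, the phase dimension of $x$ is $\dim_B\{(x(t),\dot x(t)):t\ge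 t_0\}=\frac{2}{1+\alpha}$. (ii) If $\alpha\in(0,1)$ and $\gamma\ge\alpha$, every nontrivial trajectory $\Gamma$ of (2) has $\dim_B\Gamma=\frac{2}{1+\alpha}$. (iii) If $\alpha\in(0,1)$ and $0<\gamma<\alpha$, every nontrivial trajectory $\Gamma$ of (2) has $\dim_B\Gamma=2-\frac{\alpha+\gamma}{1+\gamma}$. (iv) If $\alpha>1$ and $\gamma>0$, every trajectory $\Gamma$ of (2) is rectifiable (has finite length), and $\dim_B\Gamma=1$. In (ii)–(iv) the box dimension exists, i.e. the lower and upper box dimensions coincide; likewise in (i). -/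

import Mathlib

open Set Filter Topology MeasureTheory Asymptotics

noncomputable section

namespace SpiralTraj

/-! ### Minkowski contents and box dimension -/

/-- Lower `s`-dimensional Minkowski content: `liminf_{ε → 0+} |A_ε| / ε ^ (N - s)`, where
`A_ε` is the open `ε`-neighbourhood of `A ⊆ ℝ^N`. -/
def lowerMinkowskiContent {N : ℕ} (s : ℝ) (A : Set (EuclideanSpace ℝ (Fin N))) : ENNReal :=
  liminf (fun ε : ℝ => volume (Metric.thickening ε A) / ENNReal.ofReal (ε ^ ((N : ℝ) - s)))
    (𝓝[>] (0 : ℝ))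

/-- Upper `s`-dimensional Minkowski content. -/
def upperMinkowskiContent {N : ℕ} (s : ℝ) (A : Set (EuclideanSpace ℝ (Fin N))) : ENNReal :=
  limsup (fun ε : ℝ => volume (Metric.thickening ε A) / ENNReal.ofReal (ε ^ ((N : ℝ) - s)))
    (𝓝[>] (0 : ℝ))

/-- Lower box dimension. -/
def lowerBoxDim {N : ℕ} (A : Set (EuclideanSpace ℝ (Fin N))) : ℝ :=
  sInf {s : ℝ | 0 ≤ s ∧ lowerMinkowskiContent s A = 0}

/-- Upper box dimension. -/
def upperBoxDim {N : ℕ} (A : Set (EuclideanSpace ℝ (Fin N))) : ℝ :=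
  sInf {s : ℝ | 0 ≤ s ∧ upperMinkowskiContent s A = 0}

/-- The set `A` is bounded, its lower and upper box dimensions coincide, and `dim_B A = d`. -/
def HasBoxDim {N : ℕ} (A : Set (EuclideanSpace ℝ (Fin N))) (d : ℝ) : Prop :=
  Bornology.IsBounded A ∧ lowerBoxDim A = d ∧ upperBoxDim A = d

/-! ### Spirals -/

/-- `S` is a spiral: the graph `r = f(φ)`, `φ ≥ φ₁ > 0`, in polar coordinates of a positive,
radially decreasing function `f` tending to `0`, or the mirror image of such a graph with respect
to the `x`-axis. -/
def IsSpiral (S : Set (EuclideanSpace ℝ (Fin 2))) : Prop :=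
  ∃ (φ₁ : ℝ) (f : ℝ → ℝ), 0 < φ₁ ∧
    (∀ φ, φ₁ ≤ φ → 0 < f φ) ∧
    Tendsto f atTop (𝓝 0) ∧
    (∀ φ, φ₁ ≤ φ → StrictAnti (fun k : ℕ => f (φ + 2 * (k : ℝ) * Real.pi))) ∧
    (S = (fun φ : ℝ => !₂[f φ * Real.cos φ, f φ * Real.sin φ]) '' Ici φ₁ ∨
      S = (fun φ : ℝ => !₂[f φ * Real.cos φ, -(f φ * Real.sin φ)]) '' Ici φ₁)

/-! ### Functions on `[t₀, ∞)` -/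

/-- The `j`-th derivative of a function on `[t₀, ∞)` (one-sided at `t₀`). -/
def D (t₀ : ℝ) (j : ℕ) (f : ℝ → ℝ) (t : ℝ) : ℝ :=
  iteratedDerivWithin j f (Ici t₀) t

/-- `f : [t₀, ∞) → ℝ` is comparable of class `k` to `c t^{-α}` in the limit sense: `f` is of
class `C^k` and, for `j = 0, …, k`, the ratio of `f^{(j)}(t)` and the `j`-th derivative
`(-1)^j α (α + 1) ⋯ (α + j - 1) c t^{-α-j}` of `c t^{-α}` tends to `1` as `t → ∞`. -/
def ComparableInLimit (t₀ : ℝ) (k : ℕ) (c α : ℝ) (f : ℝ → ℝ) : Prop :=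
  ContDiffOn ℝ k f (Ici t₀) ∧
    ∀ j : ℕ, j ≤ k →
      Tendsto
        (fun t : ℝ => D t₀ j f t /
          ((-1) ^ j * (∏ i ∈ Finset.range j, (α + (i : ℝ))) * c * t ^ (-α - (j : ℝ))))
        atTop (𝓝 1)

/-! ### The second-order equation -/

/-- `2p'/p + q''/q'`. -/
def dampingCoeff (t₀ : ℝ) (p q : ℝ → ℝ) (t : ℝ) : ℝ :=
  2 * D t₀ 1 p t / p t + D t₀ 2 q t / D t₀ 1 q t

/-- `q'^2 + 2p'^2/p^2 - p''/p + p'q''/(pq')`. -/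
def restoringCoeff (t₀ : ℝ) (p q : ℝ → ℝ) (t : ℝ) : ℝ :=
  (D t₀ 1 q t) ^ 2 + 2 * (D t₀ 1 p t) ^ 2 / (p t) ^ 2 - D t₀ 2 p t / p t
    + D t₀ 1 p t * D t₀ 2 q t / (p t * D t₀ 1 q t)

/-- `x` solves `x'' - [2p'/p + q''/q'] x' + [q'^2 + 2p'^2/p^2 - p''/p + p'q''/(pq')] x = 0`
on `[t₀, ∞)`. -/
def IsSolution (t₀ : ℝ) (p q x : ℝ → ℝ) : Prop :=
  ContDiffOn ℝ 2 x (Ici t₀) ∧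
    ∀ t, t₀ ≤ t →
      D t₀ 2 x t - dampingCoeff t₀ p q t * D t₀ 1 x t + restoringCoeff t₀ p q t * x t = 0

/-- The phase curve `t ↦ (x(t), x'(t))`. -/
def phaseCurve (t₀ : ℝ) (x : ℝ → ℝ) (t : ℝ) : EuclideanSpace ℝ (Fin 2) :=
  !₂[x t, D t₀ 1 x t]

/-! ### The spatial system -/

/-- `U(z)`. -/
def U (t₀ γ : ℝ) (p q : ℝ → ℝ) (z : ℝ) : ℝ :=
  restoringCoeff t₀ p q (γ * z ^ (-1 / γ))

/-- `V(z)`. -/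
def V (t₀ γ : ℝ) (p q : ℝ → ℝ) (z : ℝ) : ℝ :=
  dampingCoeff t₀ p q (γ * z ^ (-1 / γ))

/-- `(x, y, z)` solves `x' = y`, `y' = -U(z) x + V(z) y`, `z' = -z^δ` on `[s₀, ∞)`, where
`δ = (γ + 1) / γ`, with `z ∈ (0, z₀]`. Here `z₀ = (γ / t₀)^γ`, so that `z ∈ (0, z₀]` says that the
argument `γ z^{-1/γ}` of `p` and `q` lies in `[t₀, ∞)`. -/
structure IsSystemSolution (t₀ γ : ℝ) (p q : ℝ → ℝ) (s₀ : ℝ) (x y z : ℝ → ℝ) : Prop where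
  z_pos : ∀ s, s₀ ≤ s → 0 < z s
  z_le : ∀ s, s₀ ≤ s → z s ≤ (γ / t₀) ^ γ
  x_deriv : ∀ s, s₀ ≤ s → HasDerivWithinAt x (y s) (Ici s₀) s
  y_deriv : ∀ s, s₀ ≤ s →
    HasDerivWithinAt y (-U t₀ γ p q (z s) * x s + V t₀ γ p q (z s) * y s) (Ici s₀) s
  z_deriv : ∀ s, s₀ ≤ s → HasDerivWithinAt z (-(z s) ^ ((γ + 1) / γ)) (Ici s₀) s

/-- The space curve `s ↦ (x(s), y(s), z(s))`. -/
def spaceCurve (x y z : ℝ → ℝ) (s : ℝ) : EuclideanSpace ℝ (Fin 3) :=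
  !₂[x s, y s, z s]

/-- The curve `c : [s₀, ∞) → ℝ^N` has finite length. -/
def IsRectifiable {N : ℕ} (c : ℝ → EuclideanSpace ℝ (Fin N)) (s₀ : ℝ) : Prop :=
  eVariationOn c (Ici s₀) < ⊤

end SpiralTraj

end

/-!
The damping and the restoring coefficient are chosen so that `p * sin q` and `p * cos q` solve the
equation; hence every solution is `A * p * sin (q + θ)`, and its phase portrait turns around the
origin at a distance of order `t ^ (-α)`. Once this normal form is known, every claim follows from
the size of `p`, `q` and their derivatives.

* *Box dimension.* Up to a time `T` the curve has length of order `T ^ (1 - α)`, while its tail is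
  controlled by the two coordinates `t ^ (-m)` and `q + θ` mod `2π`; conversely, a planar projection
  of the tail comes within `O(T ^ (-m - 1))` of every point of a region of area of order
  `T ^ (-(α + m))`. Here `m = α` when one projects to the phase plane and `m = γ` when one projects
  to the `(x, z)`-plane. At the scale `ε = T ^ (-m - 1)` all these bounds agree. For `α > 1` the
  curve has finite length.

* *Spiral.* The angular velocity of the phase portrait is eventually bounded away from zero. The
  radius decreases from one turn to the next since the amplitude `A` that belongs to a fixed phase
  point increases with time, whereas the amplitude is constant along a solution.
-/

noncomputable section

namespace SpiralTraj

/-! ### Box dimension and covering numbers -/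

section BoxDim

variable {N : ℕ} {A : Set (EuclideanSpace ℝ (Fin N))} {d s c C : ℝ}

theorem lowerMinkowskiContent_le_upperMinkowskiContent (s : ℝ)
    (A : Set (EuclideanSpace ℝ (Fin N))) :
    lowerMinkowskiContent s A ≤ upperMinkowskiContent s A :=
  liminf_le_limsup

theorem upperMinkowskiContent_eq_zero (hds : d < s)
    (h : ∀ᶠ ε : ℝ in 𝓝[>] 0,
      volume (Metric.thickening ε A) ≤ ENNReal.ofReal (C * ε ^ ((N : ℝ) - d))) :
    upperMinkowskiContent s A = 0 := by
  have hlim : Tendsto (fun ε : ℝ => ENNReal.ofReal (C * ε ^ (s - d))) (𝓝[>] 0) (𝓝 0) := by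
    have hcont : ContinuousAt (fun ε : ℝ => C * ε ^ (s - d)) 0 :=
      continuousAt_const.mul (Real.continuousAt_rpow_const _ _ (Or.inr (by linarith)))
    have h0 := hcont.tendsto
    rw [Real.zero_rpow (by linarith), mul_zero] at h0
    simpa using ENNReal.tendsto_ofReal (h0.mono_left nhdsWithin_le_nhds)
  refine (tendsto_of_tendsto_of_tendsto_of_le_of_le' tendsto_const_nhds hlim
    (Eventually.of_forall fun _ => zero_le) ?_).limsup_eq
  filter_upwards [h, eventually_mem_nhdsWithin] with ε hε (hε0 : 0 < ε)
  refine ENNReal.div_le_of_le_mul (hε.trans_eq ?_)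
  rw [← ENNReal.ofReal_mul' (by positivity), mul_assoc, ← Real.rpow_add hε0]
  ring_nf

theorem ofReal_le_lowerMinkowskiContent (hsd : s ≤ d) (hc : 0 ≤ c)
    (h : ∀ᶠ ε : ℝ in 𝓝[>] 0,
      ENNReal.ofReal (c * ε ^ ((N : ℝ) - d)) ≤ volume (Metric.thickening ε A)) :
    ENNReal.ofReal c ≤ lowerMinkowskiContent s A := by
  refine le_liminf_of_le (by isBoundedDefault) ?_
  filter_upwards [h, Ioo_mem_nhdsGT zero_lt_one] with ε hε ⟨hε0, hε1⟩
  have hpos : 0 < ε ^ ((N : ℝ) - s) := by positivity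
  rw [ENNReal.le_div_iff_mul_le (Or.inl (by simpa using hpos)) (Or.inl ENNReal.ofReal_ne_top),
    ← ENNReal.ofReal_mul hc]
  refine (ENNReal.ofReal_le_ofReal (mul_le_mul_of_nonneg_left ?_ hc)).trans hε
  exact Real.rpow_le_rpow_of_exponent_ge hε0 hε1.le (by linarith)

theorem hasBoxDim_of_volume_thickening (hA : Bornology.IsBounded A) (hd : 0 ≤ d) (hc : 0 < c)
    (hlow : ∀ᶠ ε : ℝ in 𝓝[>] 0,
      ENNReal.ofReal (c * ε ^ ((N : ℝ) - d)) ≤ volume (Metric.thickening ε A))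
    (hup : ∀ᶠ ε : ℝ in 𝓝[>] 0,
      volume (Metric.thickening ε A) ≤ ENNReal.ofReal (C * ε ^ ((N : ℝ) - d))) :
    HasBoxDim A d := by
  have hzero : ∀ s, d < s → upperMinkowskiContent s A = 0 :=
    fun s hs => upperMinkowskiContent_eq_zero hs hup
  have hle : ∀ s, lowerMinkowskiContent s A = 0 → d ≤ s := fun s hs => by
    by_contra! hlt
    have := ofReal_le_lowerMinkowskiContent hlt.le hc.le hlow
    exact hc.not_ge (by simpa [hs] using this)
  have hlow_of_up : ∀ s, upperMinkowskiContent s A = 0 → lowerMinkowskiContent s A = 0 :=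
    fun s hs => le_zero_iff.1 (hs ▸ lowerMinkowskiContent_le_upperMinkowskiContent s A)
  have hsInf : ∀ S : Set ℝ, Ioi d ⊆ S → S ⊆ Ici d → sInf S = d := fun S h₁ h₂ =>
    (isGLB_Ioi.of_subset_of_superset isGLB_Ici h₁ h₂).csInf_eq (nonempty_Ioi.mono h₁)
  refine ⟨hA, hsInf _ (fun s hs => ?_) fun s hs => hle s hs.2,
    hsInf _ (fun s hs => ?_) fun s hs => hle s (hlow_of_up s hs.2)⟩
  · exact ⟨hd.trans (le_of_lt hs), hlow_of_up s (hzero s hs)⟩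
  · exact ⟨hd.trans (le_of_lt hs), hzero s hs⟩

end BoxDim

section CoveringNumber

open scoped NNReal ENNReal
open Metric

variable {X Y : Type*} [PseudoMetricSpace X] [PseudoMetricSpace Y]

theorem coveringNumber_image_le_of_lipschitzWith {f : X → Y} (hf : LipschitzWith 1 f) (δ : ℝ≥0)
    (A : Set X) : coveringNumber δ (f '' A) ≤ coveringNumber δ A := by
  refine le_iInf₂ fun C hCA => le_iInf fun hC => ?_
  have hcover := hC.image_lipschitz hf
  rw [one_mul] at hcover
  exact (hcover.coveringNumber_le_encard (image_mono hCA)).trans (encard_image_le f C)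

theorem coveringNumber_image_le_card {ι κ : Type*} {S : Set ι} {f : ι → X} {δ : ℝ≥0}
    {label : ι → κ} {I : Finset κ} (hI : ∀ s ∈ S, label s ∈ I)
    (hf : ∀ s ∈ S, ∀ t ∈ S, label s = label t → dist (f s) (f t) ≤ δ) :
    coveringNumber δ (f '' S) ≤ I.card := by
  obtain ⟨R, hRS, hbij⟩ := (surjOn_image label S).exists_bijOn_subset
  have himage : label '' R = label '' S := hbij.image_eq
  have hcover : IsCover δ (f '' S) (f '' R) := by
    rintro _ ⟨s, hs, rfl⟩
    obtain ⟨r, hr, hrs⟩ : label s ∈ label '' R := himage ▸ mem_image_of_mem label hs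
    exact ⟨f r, mem_image_of_mem f hr,
      edist_le_coe.2 (dist_le_coe.1 (hf s hs r (hRS hr) hrs.symm))⟩
  calc coveringNumber δ (f '' S) ≤ (f '' R).encard :=
        hcover.coveringNumber_le_encard (image_mono hRS)
    _ ≤ (label '' R).encard := (encard_image_le f R).trans_eq hbij.injOn.encard_image.symm
    _ ≤ (I : Set κ).encard := encard_le_encard (himage ▸ image_subset_iff.2 hI)
    _ = I.card := encard_coe_eq_coe_finsetCard I

variable [MeasurableSpace X] {μ : Measure X} {v : ℝ≥0∞} {δ ε : ℝ≥0}

theorem measure_thickening_le_coveringNumber_mul (hv₀ : v ≠ 0)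
    (hv : ∀ x, μ (ball x (δ + ε)) ≤ v) (A : Set X) :
    μ (thickening ε A) ≤ coveringNumber δ A * v := by
  by_cases htop : coveringNumber δ A = ⊤
  · simp [htop, ENNReal.top_mul hv₀]
  obtain ⟨C, -, hfin, hcover, hcard⟩ := exists_set_encard_eq_coveringNumber htop
  have hsub : thickening ε A ⊆ ⋃ c ∈ C, ball c (δ + ε) := by
    intro y hy
    obtain ⟨a, ha, hya⟩ := mem_thickening_iff.1 hy
    obtain ⟨c, hc, hac⟩ := mem_iUnion₂.1 (isCover_iff_subset_iUnion_closedBall.1 hcover ha)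
    refine mem_iUnion₂.2 ⟨c, hc, ?_⟩
    rw [mem_ball]
    linarith [dist_triangle y a c, mem_closedBall.1 hac]
  calc μ (thickening ε A) ≤ ∑' c : C, μ (ball (c : X) (δ + ε)) :=
        (measure_mono hsub).trans (measure_biUnion_le μ hfin.countable _)
    _ ≤ ∑' _ : C, v := ENNReal.tsum_le_tsum fun c => hv c
    _ = coveringNumber δ A * v := by rw [ENNReal.tsum_const, ← hcard]; rfl

theorem packingNumber_mul_le_measure_thickening [OpensMeasurableSpace X]
    (hv : ∀ x, v ≤ μ (ball x ε)) (A : Set X) :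
    packingNumber (2 * ε) A * v ≤ μ (thickening ε A) := by
  simp only [packingNumber, ENat.toENNReal_iSup, ENNReal.iSup_mul, iSup_le_iff]
  intro C hCA hC
  have hdisj : Pairwise (Function.onFun Disjoint fun c : C => ball (c : X) ε) := by
    intro a b hab
    have hsep : ((2 * ε : ℝ≥0) : ℝ≥0∞) < edist (a : X) b :=
      hC a.2 b.2 (Subtype.coe_injective.ne hab)
    rw [edist_nndist, ENNReal.coe_lt_coe, ← NNReal.coe_lt_coe, coe_nndist, NNReal.coe_mul] at hsep
    exact ball_disjoint_ball ((two_mul (ε : ℝ)).symm.trans_le hsep.le)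
  calc (C.encard : ℝ≥0∞) * v = ∑' _ : C, v := by rw [ENNReal.tsum_const]; rfl
    _ ≤ ∑' c : C, μ (ball (c : X) ε) := ENNReal.tsum_le_tsum fun c => hv c
    _ ≤ μ (⋃ c : C, ball (c : X) ε) :=
        tsum_meas_le_meas_iUnion_of_disjoint μ (fun _ => measurableSet_ball) hdisj
    _ ≤ μ (thickening ε A) :=
        measure_mono (iUnion_subset fun c => ball_subset_thickening (hCA c.2) ε)

end CoveringNumber

section Euclidean

open scoped NNReal ENNReal

/-- The volume of the unit ball of `ℝ ^ N`, as a real number: the constant in volume estimates by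
balls. -/
def unitBallVolume (N : ℕ) : ℝ := volume.real (Metric.ball (0 : EuclideanSpace ℝ (Fin N)) 1)

theorem unitBallVolume_pos (N : ℕ) : 0 < unitBallVolume N :=
  ENNReal.toReal_pos (Metric.measure_ball_pos _ _ one_pos).ne' measure_ball_lt_top.ne

theorem volume_ball_eq {N : ℕ} (x : EuclideanSpace ℝ (Fin N)) {r : ℝ} (hr : 0 < r) :
    volume (Metric.ball x r) = ENNReal.ofReal (unitBallVolume N * r ^ N) := by
  rw [Measure.addHaar_ball_of_pos _ _ hr, unitBallVolume, mul_comm,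
    ENNReal.ofReal_mul measureReal_nonneg, ofReal_measureReal, finrank_euclideanSpace_fin]

theorem abs_sub_le_of_floor_div_eq {a b ε : ℝ} (ha : 0 ≤ a) (hb : 0 ≤ b) (hε : 0 < ε)
    (h : ⌊a / ε⌋₊ = ⌊b / ε⌋₊) : |a - b| ≤ ε := by
  have hfloor : ⌊a / ε⌋ = ⌊b / ε⌋ := by
    rw [← Int.natCast_floor_eq_floor (by positivity), h, Int.natCast_floor_eq_floor (by positivity)]
  have := (Int.abs_sub_lt_one_of_floor_eq_floor hfloor).le
  rwa [← sub_div, abs_div, abs_of_pos hε, div_le_one hε] at this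

variable {ι : Type*} {S : Set ι} {N : ℕ} {f : ι → EuclideanSpace ℝ (Fin N)} {u v : ι → ℝ}
  {L₁ L₂ ε : ℝ}

theorem volume_thickening_image_le_of_grid (hε : 0 < ε) (hL₁ : 0 ≤ L₁) (hL₂ : 0 ≤ L₂)
    (hu : ∀ s ∈ S, u s ∈ Icc 0 L₁) (hv : ∀ s ∈ S, v s ∈ Icc 0 L₂)
    (hf : ∀ s ∈ S, ∀ t ∈ S, dist (f s) (f t) ≤ |u s - u t| + |v s - v t|) :
    volume (Metric.thickening ε (f '' S)) ≤
      ENNReal.ofReal ((L₁ / ε + 1) * (L₂ / ε + 1) * (unitBallVolume N * (3 * ε) ^ N)) := by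
  lift ε to ℝ≥0 using hε.le
  let I := Finset.range (⌊L₁ / ε⌋₊ + 1) ×ˢ Finset.range (⌊L₂ / ε⌋₊ + 1)
  have hcard : (I.card : ℝ) ≤ (L₁ / ε + 1) * (L₂ / ε + 1) := by
    rw [Finset.card_product, Finset.card_range, Finset.card_range, Nat.cast_mul, Nat.cast_succ,
      Nat.cast_succ]
    gcongr <;> exact Nat.floor_le (by positivity)
  have hcover : Metric.coveringNumber (2 * ε) (f '' S) ≤ I.card := by
    refine coveringNumber_image_le_card
      (label := fun s => (⌊u s / (ε : ℝ)⌋₊, ⌊v s / (ε : ℝ)⌋₊)) (fun s hs => ?_)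
      fun s hs t ht hst => (hf s hs t ht).trans ?_
    · simp only [I, Finset.mem_product, Finset.mem_range, Nat.lt_succ_iff]
      exact ⟨Nat.floor_mono (by gcongr; exact (hu s hs).2),
        Nat.floor_mono (by gcongr; exact (hv s hs).2)⟩
    · rw [NNReal.coe_mul, NNReal.coe_ofNat, two_mul]
      exact add_le_add
        (abs_sub_le_of_floor_div_eq (hu s hs).1 (hu t ht).1 hε (congrArg Prod.fst hst))
        (abs_sub_le_of_floor_div_eq (hv s hs).1 (hv t ht).1 hε (congrArg Prod.snd hst))
  have hball : 0 < unitBallVolume N * (3 * (ε : ℝ)) ^ N :=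
    mul_pos (unitBallVolume_pos N) (by positivity)
  calc volume (Metric.thickening ε (f '' S))
      ≤ Metric.coveringNumber (2 * ε) (f '' S) *
          ENNReal.ofReal (unitBallVolume N * (3 * (ε : ℝ)) ^ N) := by
        refine measure_thickening_le_coveringNumber_mul (by simpa using hball)
          (fun x => (volume_ball_eq x (by positivity)).trans_le ?_) _
        push_cast
        ring_nf
        exact le_rfl
    _ ≤ I.card * ENNReal.ofReal (unitBallVolume N * (3 * (ε : ℝ)) ^ N) := by
        gcongr
        exact_mod_cast hcover
    _ = ENNReal.ofReal (I.card * (unitBallVolume N * (3 * (ε : ℝ)) ^ N)) := by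
        rw [ENNReal.ofReal_mul (Nat.cast_nonneg _), ENNReal.ofReal_natCast]
    _ ≤ _ := ENNReal.ofReal_le_ofReal (mul_le_mul_of_nonneg_right hcard hball.le)

theorem volume_thickening_image_le_of_arc (hε : 0 < ε) (hL₁ : 0 ≤ L₁)
    (hu : ∀ s ∈ S, u s ∈ Icc 0 L₁)
    (hf : ∀ s ∈ S, ∀ t ∈ S, dist (f s) (f t) ≤ |u s - u t|) :
    volume (Metric.thickening ε (f '' S)) ≤
      ENNReal.ofReal ((L₁ / ε + 1) * (unitBallVolume N * (3 * ε) ^ N)) := by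
  simpa using volume_thickening_image_le_of_grid (v := fun _ => 0) hε hL₁ le_rfl hu
    (fun _ _ => ⟨le_rfl, le_rfl⟩) fun s hs t ht => by simpa using hf s hs t ht

/-- The `ε`-balls around `2 * ε`-separated points of `A` are disjoint, and the `3 * ε`-balls around
the projections of a maximal family of such points cover `B`. -/
theorem ofReal_le_volume_thickening {F : Type*} [PseudoMetricSpace F] [MeasureSpace F]
    {π : EuclideanSpace ℝ (Fin N) → F} (hπ : LipschitzWith 1 π) {k : ℕ} {b C : ℝ} (hC : 0 < C)
    (hball : ∀ (x : F) (r : ℝ), 0 < r → volume (Metric.ball x r) ≤ ENNReal.ofReal (C * r ^ k))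
    {A : Set (EuclideanSpace ℝ (Fin N))} {B : Set F} (hε : 0 < ε)
    (hB : B ⊆ Metric.thickening ε (π '' A)) (hb : ENNReal.ofReal b ≤ volume B) :
    ENNReal.ofReal (b * (unitBallVolume N * ε ^ N) / (C * (3 * ε) ^ k)) ≤
      volume (Metric.thickening ε A) := by
  lift ε to ℝ≥0 using hε.le
  have hCε : 0 < C * (3 * (ε : ℝ)) ^ k := by positivity
  have hNε : 0 ≤ unitBallVolume N * (ε : ℝ) ^ N :=
    mul_nonneg (unitBallVolume_pos N).le (by positivity)
  have hcover : volume B ≤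
      Metric.coveringNumber (2 * ε) (π '' A) * ENNReal.ofReal (C * (3 * (ε : ℝ)) ^ k) := by
    refine (measure_mono hB).trans (measure_thickening_le_coveringNumber_mul
      (by simpa using hCε) (fun x => (hball x _ (by positivity)).trans_eq ?_) _)
    push_cast
    ring_nf
  rw [ENNReal.ofReal_div_of_pos hCε, ENNReal.ofReal_mul' hNε]
  refine ENNReal.div_le_of_le_mul ?_
  calc ENNReal.ofReal b * ENNReal.ofReal (unitBallVolume N * (ε : ℝ) ^ N)
      ≤ Metric.packingNumber (2 * ε) A * ENNReal.ofReal (C * (3 * (ε : ℝ)) ^ k) *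
          ENNReal.ofReal (unitBallVolume N * (ε : ℝ) ^ N) := by
        gcongr
        refine (hb.trans hcover).trans ?_
        gcongr
        exact (coveringNumber_image_le_of_lipschitzWith hπ _ A).trans
          (Metric.coveringNumber_le_packingNumber _ A)
    _ = Metric.packingNumber (2 * ε) A * ENNReal.ofReal (unitBallVolume N * (ε : ℝ) ^ N) *
          ENNReal.ofReal (C * (3 * (ε : ℝ)) ^ k) := by ring
    _ ≤ _ := by
        gcongr
        exact packingNumber_mul_le_measure_thickening (fun x => (volume_ball_eq x hε).ge) A

end Euclidean

/-! ### Box dimension of curves with power-law winding -/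

section PowerCurves

/-- The curve `f` is Lipschitz on `[t₁, ∞)` with respect to the coordinate `t ^ β`; this is what a
speed of order `t ^ (β - 1)` gives, for either sign of `β ≠ 0`. -/
def IsPowerLipschitz {X : Type*} [PseudoMetricSpace X] (t₁ β : ℝ) (f : ℝ → X) : Prop :=
  ∃ C, 0 < C ∧ ∀ s t, t₁ ≤ s → t₁ ≤ t → dist (f s) (f t) ≤ C * |s ^ β - t ^ β|

/-- The points of the curve `f` on `[T, ∞)` are controlled by the two coordinates `t ^ (-m)` and
`ang t`, the latter weighted by the amplitude `T ^ (-α)`; the angle `ang` is meant to be bounded,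
whereas its lift along `f` need not be. -/
def IsPowerLipschitzModAngle {X : Type*} [PseudoMetricSpace X] (t₁ α m : ℝ) (ang : ℝ → ℝ)
    (f : ℝ → X) : Prop :=
  ∃ C, 0 < C ∧ ∀ T s t, t₁ ≤ T → T ≤ s → T ≤ t →
    dist (f s) (f t) ≤ C * |s ^ (-m) - t ^ (-m)| + C * T ^ (-α) * |ang s - ang t|

/-- For large `T`, the `O(T ^ (-m - 1))`-neighbourhood of the planar set `S` contains a region of
area at least of order `T ^ (-α - m)`. -/
def HasDenseRegions (α m : ℝ) (S : Set (ℝ × ℝ)) : Prop :=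
  ∃ κ M : ℝ, 0 < κ ∧ 0 < M ∧ ∀ᶠ T : ℝ in atTop, ∃ B : Set (ℝ × ℝ),
    ENNReal.ofReal (κ * T ^ (-α - m)) ≤ volume B ∧ B ⊆ Metric.thickening (M * T ^ (-m - 1)) S

theorem eventually_nhdsGT_zero_of_rpow {P : ℝ → Prop} {M k : ℝ} (hM : 0 < M) (hk : 0 < k)
    (h : ∀ᶠ T : ℝ in atTop, P (M * T ^ (-k))) : ∀ᶠ ε : ℝ in 𝓝[>] 0, P ε := by
  have hdiv : Tendsto (fun ε : ℝ => ε / M) (𝓝[>] 0) (𝓝[>] 0) := by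
    refine tendsto_nhdsWithin_iff.2 ⟨?_, ?_⟩
    · simpa using (tendsto_id.div_const M).mono_left (nhdsWithin_le_nhds (a := (0 : ℝ)))
    · filter_upwards [eventually_mem_nhdsWithin] with ε hε using div_pos hε hM
  have hscale : Tendsto (fun ε : ℝ => (ε / M) ^ (-k⁻¹)) (𝓝[>] 0) atTop :=
    (tendsto_rpow_neg_nhdsGT_zero (by simpa using hk)).comp hdiv
  filter_upwards [hscale.eventually h, eventually_mem_nhdsWithin] with ε hε (hε₀ : 0 < ε)
  rw [← Real.rpow_mul (by positivity), neg_mul_neg, inv_mul_cancel₀ hk.ne', Real.rpow_one,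
    mul_div_cancel₀ _ hM.ne'] at hε
  exact hε

variable {N : ℕ} {f : ℝ → EuclideanSpace ℝ (Fin N)} {t₁ α β m : ℝ} {ang : ℝ → ℝ}

theorem IsPowerLipschitz.exists_volume_thickening_le (hf : IsPowerLipschitz t₁ β f)
    (ht₁ : 0 < t₁) (hβ : 0 < β) :
    ∃ C, 0 < C ∧ ∀ T ε, t₁ ≤ T → 0 < ε → volume (Metric.thickening ε (f '' Icc t₁ T)) ≤
      ENNReal.ofReal (C * ((T ^ β / ε + 1) * ε ^ N)) := by
  obtain ⟨C, hC, hf⟩ := hf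
  have hV := unitBallVolume_pos N
  refine ⟨(C + 1) * (unitBallVolume N * 3 ^ N), by positivity, fun T ε hT hε => ?_⟩
  have hT0 : 0 < T := ht₁.trans_le hT
  refine (volume_thickening_image_le_of_arc (u := fun t => C * t ^ β) (L₁ := C * T ^ β) hε
    (by positivity) (fun s hs => ?_) fun s hs t ht => ?_).trans (ENNReal.ofReal_le_ofReal ?_)
  · have hs0 : 0 < s := ht₁.trans_le hs.1
    exact ⟨by positivity, by gcongr; exact hs.2⟩
  · rw [← mul_sub, abs_mul, abs_of_pos hC]
    exact hf s t hs.1 ht.1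
  · have hX : 0 < T ^ β / ε := by positivity
    calc (C * T ^ β / ε + 1) * (unitBallVolume N * (3 * ε) ^ N)
        = (C * (T ^ β / ε) + 1) * (unitBallVolume N * 3 ^ N * ε ^ N) := by ring
      _ ≤ ((C + 1) * (T ^ β / ε + 1)) * (unitBallVolume N * 3 ^ N * ε ^ N) := by
          gcongr
          nlinarith
      _ = _ := by ring

theorem IsPowerLipschitzModAngle.exists_volume_thickening_le
    (hf : IsPowerLipschitzModAngle t₁ α m ang f) (ht₁ : 0 < t₁) (hm : 0 < m)
    (hang : ∀ t, ang t ∈ Icc 0 (2 * Real.pi)) :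
    ∃ C, 0 < C ∧ ∀ T ε, t₁ ≤ T → 0 < ε → volume (Metric.thickening ε (f '' Ici T)) ≤
      ENNReal.ofReal (C * ((T ^ (-m) / ε + 1) * (T ^ (-α) / ε + 1) * ε ^ N)) := by
  obtain ⟨C, hC, hf⟩ := hf
  have hV := unitBallVolume_pos N
  refine ⟨(C + 1) * (C * (2 * Real.pi) + 1) * (unitBallVolume N * 3 ^ N), by positivity,
    fun T ε hT hε => ?_⟩
  have hT0 : 0 < T := ht₁.trans_le hT
  refine (volume_thickening_image_le_of_grid (u := fun t => C * t ^ (-m))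
    (v := fun t => C * T ^ (-α) * ang t) (L₁ := C * T ^ (-m))
    (L₂ := C * T ^ (-α) * (2 * Real.pi)) hε (by positivity) (by positivity) (fun s hs => ?_)
    (fun s _ => ?_) fun s hs t ht => ?_).trans (ENNReal.ofReal_le_ofReal ?_)
  · have hs0 : 0 < s := hT0.trans_le hs
    have := Real.rpow_le_rpow_of_nonpos hT0 hs (neg_nonpos.2 hm.le)
    exact ⟨by positivity, by gcongr⟩
  · exact ⟨mul_nonneg (by positivity) (hang s).1, by gcongr; exact (hang s).2⟩
  · rw [← mul_sub, ← mul_sub (C * T ^ (-α)), abs_mul, abs_mul (C * T ^ (-α)), abs_of_pos hC,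
      abs_of_pos (by positivity : 0 < C * T ^ (-α))]
    exact hf T s t hT hs ht
  · have hX : 0 < T ^ (-m) / ε := by positivity
    have hY : 0 < T ^ (-α) / ε := by positivity
    calc (C * T ^ (-m) / ε + 1) * (C * T ^ (-α) * (2 * Real.pi) / ε + 1) *
          (unitBallVolume N * (3 * ε) ^ N)
        = (C * (T ^ (-m) / ε) + 1) * (C * (2 * Real.pi) * (T ^ (-α) / ε) + 1) *
          (unitBallVolume N * 3 ^ N * ε ^ N) := by ring
      _ ≤ ((C + 1) * (T ^ (-m) / ε + 1)) *
          ((C * (2 * Real.pi) + 1) * (T ^ (-α) / ε + 1)) *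
          (unitBallVolume N * 3 ^ N * ε ^ N) := by
          gcongr
          · nlinarith
          · nlinarith [mul_pos hC Real.two_pi_pos]
      _ = _ := by ring

theorem rpow_mul_rpow_neg_pow_eq {T : ℝ} (hT : 0 < T) (hm : 1 + m ≠ 0) (N : ℕ) :
    T ^ (2 + m - α) * (T ^ (-(1 + m))) ^ N =
      (T ^ (-(1 + m))) ^ ((N : ℝ) - (2 - (α + m) / (1 + m))) := by
  rw [Real.rpow_sub (by positivity : 0 < T ^ (-(1 + m))), Real.rpow_natCast, div_eq_mul_inv,
    ← Real.rpow_neg (by positivity), ← Real.rpow_mul hT.le (-(1 + m)), mul_comm]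
  congr 2
  field_simp
  ring

theorem exists_volume_thickening_image_Ici_le (hhead : IsPowerLipschitz t₁ (1 - α) f)
    (htail : IsPowerLipschitzModAngle t₁ α m ang f) (ht₁ : 0 < t₁) (hm : 0 < m) (hα : α < 1)
    (hang : ∀ t, ang t ∈ Icc 0 (2 * Real.pi)) :
    ∃ C, ∀ᶠ ε : ℝ in 𝓝[>] 0, volume (Metric.thickening ε (f '' Ici t₁)) ≤
      ENNReal.ofReal (C * ε ^ ((N : ℝ) - (2 - (α + m) / (1 + m)))) := by
  obtain ⟨C₁, hC₁, hhead⟩ := hhead.exists_volume_thickening_le ht₁ (sub_pos.2 hα)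
  obtain ⟨C₂, hC₂, htail⟩ := htail.exists_volume_thickening_le ht₁ hm hang
  refine ⟨2 * C₁ + 4 * C₂, eventually_nhdsGT_zero_of_rpow one_pos (k := 1 + m) (by linarith) ?_⟩
  filter_upwards [eventually_ge_atTop t₁, eventually_ge_atTop 1] with T hT hT1
  have hT0 : 0 < T := ht₁.trans_le hT
  rw [one_mul]
  set ε := T ^ (-(1 + m)) with hε_def
  have hε : 0 < ε := by positivity
  have hdiv : ∀ a : ℝ, T ^ a / ε = T ^ (a + 1 + m) := fun a => by
    rw [hε_def, ← Real.rpow_sub hT0]; ring_nf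
  have hone : ∀ a : ℝ, 0 ≤ a → T ^ a + 1 ≤ 2 * T ^ a := fun a ha => by
    linarith [Real.one_le_rpow hT1 ha]
  have hhead' : (T ^ (1 - α) / ε + 1) * ε ^ N ≤ 2 * T ^ (2 + m - α) * ε ^ N := by
    rw [hdiv, show 1 - α + 1 + m = 2 + m - α by ring]
    gcongr
    exact hone _ (by linarith)
  have htail' : (T ^ (-m) / ε + 1) * (T ^ (-α) / ε + 1) * ε ^ N ≤
      4 * T ^ (2 + m - α) * ε ^ N := by
    rw [hdiv, hdiv]
    gcongr ?_ * _
    calc (T ^ (-m + 1 + m) + 1) * (T ^ (-α + 1 + m) + 1)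
        ≤ (2 * T ^ (-m + 1 + m)) * (2 * T ^ (-α + 1 + m)) := by
          gcongr <;> exact hone _ (by linarith)
      _ = 4 * (T ^ (-m + 1 + m) * T ^ (-α + 1 + m)) := by ring
      _ = 4 * T ^ (2 + m - α) := by rw [← Real.rpow_add hT0]; ring_nf
  calc volume (Metric.thickening ε (f '' Ici t₁))
      = volume (Metric.thickening ε (f '' Icc t₁ T) ∪ Metric.thickening ε (f '' Ici T)) := by
        rw [← Metric.thickening_union, ← image_union, Icc_union_Ici_eq_Ici hT]
    _ ≤ _ := (measure_union_le _ _).trans (add_le_add (hhead T ε hT hε) (htail T ε hT hε))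
    _ = ENNReal.ofReal (C₁ * ((T ^ (1 - α) / ε + 1) * ε ^ N) +
          C₂ * ((T ^ (-m) / ε + 1) * (T ^ (-α) / ε + 1) * ε ^ N)) :=
        (ENNReal.ofReal_add (by positivity) (by positivity)).symm
    _ ≤ ENNReal.ofReal (C₁ * (2 * T ^ (2 + m - α) * ε ^ N) +
          C₂ * (4 * T ^ (2 + m - α) * ε ^ N)) := by gcongr
    _ = _ := by rw [hε_def, ← rpow_mul_rpow_neg_pow_eq hT0 (by linarith) N]; ring_nf

theorem IsPowerLipschitzModAngle.isBounded_image (hf : IsPowerLipschitzModAngle t₁ α m ang f)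
    (ht₁ : 0 < t₁) (hm : 0 < m) (hang : ∀ t, ang t ∈ Icc 0 (2 * Real.pi)) :
    Bornology.IsBounded (f '' Ici t₁) := by
  obtain ⟨C, hC, hf⟩ := hf
  refine (Metric.isBounded_closedBall (x := f t₁)
    (r := C * t₁ ^ (-m) + C * t₁ ^ (-α) * (2 * Real.pi))).subset ?_
  rintro _ ⟨t, ht, rfl⟩
  rw [Metric.mem_closedBall']
  refine (hf t₁ t₁ t le_rfl le_rfl ht).trans ?_
  have ht0 : 0 < t := ht₁.trans_le ht
  have hpow : |t₁ ^ (-m) - t ^ (-m)| ≤ t₁ ^ (-m) :=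
    abs_sub_le_of_nonneg_of_le (by positivity) le_rfl (by positivity)
      (Real.rpow_le_rpow_of_nonpos ht₁ ht (neg_nonpos.2 hm.le))
  have hdist : |ang t₁ - ang t| ≤ 2 * Real.pi :=
    abs_sub_le_of_nonneg_of_le (hang t₁).1 (hang t₁).2 (hang t).1 (hang t).2
  gcongr

theorem volume_ball_prod_le (x : ℝ × ℝ) (r : ℝ) (hr : 0 < r) :
    volume (Metric.ball x r) ≤ ENNReal.ofReal (4 * r ^ 2) := by
  rw [← ball_prod_same, Measure.volume_eq_prod, Measure.prod_prod, Real.volume_ball,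
    Real.volume_ball, ← ENNReal.ofReal_mul (by positivity)]
  exact ENNReal.ofReal_le_ofReal (by nlinarith)

theorem HasDenseRegions.exists_le_volume_thickening {A : Set (EuclideanSpace ℝ (Fin N))}
    {π : EuclideanSpace ℝ (Fin N) → ℝ × ℝ} (h : HasDenseRegions α m (π '' A)) (hm : 0 < m)
    (hπ : LipschitzWith 1 π) :
    ∃ c, 0 < c ∧ ∀ᶠ ε : ℝ in 𝓝[>] 0,
      ENNReal.ofReal (c * ε ^ ((N : ℝ) - (2 - (α + m) / (1 + m)))) ≤
        volume (Metric.thickening ε A) := by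
  obtain ⟨κ, M, hκ, hM, h⟩ := h
  have hV := unitBallVolume_pos N
  set e := (α + m) / (1 + m) with he
  refine ⟨κ * M ^ (-e) * unitBallVolume N / 36, by positivity,
    eventually_nhdsGT_zero_of_rpow hM (k := 1 + m) (by linarith) ?_⟩
  filter_upwards [h, eventually_gt_atTop 0] with T ⟨B, hB, hsub⟩ hT
  rw [show -m - 1 = -(1 + m) by ring] at hsub
  set ε := M * T ^ (-(1 + m)) with hε_def
  have hε : 0 < ε := by positivity
  have hpow : T ^ (-α - m) = M ^ (-e) * ε ^ e := by
    rw [hε_def, Real.mul_rpow hM.le (by positivity), ← mul_assoc, ← Real.rpow_add hM,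
      neg_add_cancel, Real.rpow_zero, one_mul, ← Real.rpow_mul hT.le, he]
    congr 1
    field_simp
    ring
  convert ofReal_le_volume_thickening hπ (by norm_num) volume_ball_prod_le hε hsub hB using 2
  rw [hpow, show (N : ℝ) - (2 - e) = N + e - (2 : ℕ) by push_cast; ring,
    Real.rpow_sub hε, Real.rpow_add hε, Real.rpow_natCast, Real.rpow_natCast]
  field_simp
  ring

theorem hasBoxDim_of_isPowerLipschitz_of_hasDenseRegions
    (hhead : IsPowerLipschitz t₁ (1 - α) f) (htail : IsPowerLipschitzModAngle t₁ α m ang f)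
    (ht₁ : 0 < t₁) (hm : 0 < m) (hα : α < 1) (hang : ∀ t, ang t ∈ Icc 0 (2 * Real.pi))
    {π : EuclideanSpace ℝ (Fin N) → ℝ × ℝ} (hπ : LipschitzWith 1 π)
    (hregions : HasDenseRegions α m (π '' (f '' Ici t₁))) :
    HasBoxDim (f '' Ici t₁) (2 - (α + m) / (1 + m)) := by
  obtain ⟨C, hup⟩ := exists_volume_thickening_image_Ici_le hhead htail ht₁ hm hα hang
  obtain ⟨c, hc, hlow⟩ := hregions.exists_le_volume_thickening hm hπ
  refine hasBoxDim_of_volume_thickening (htail.isBounded_image ht₁ hm hang) ?_ hc hlow hup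
  rw [sub_nonneg, div_le_iff₀ (by linarith)]
  linarith

end PowerCurves

section FiniteLength

theorem IsPowerLipschitz.isRectifiable {N : ℕ} {f : ℝ → EuclideanSpace ℝ (Fin N)} {t₁ μ : ℝ}
    (hf : IsPowerLipschitz t₁ (-μ) f) (ht₁ : 0 < t₁) (hμ : 0 < μ) : IsRectifiable f t₁ := by
  obtain ⟨C, hC, hf⟩ := hf
  set I := Ioc 0 (t₁ ^ (-μ))
  have hinv : ∀ t : ℝ, 0 < t → (t ^ (-μ)) ^ (-μ⁻¹) = t := fun t ht => by
    rw [← Real.rpow_mul ht.le, neg_mul_neg, mul_inv_cancel₀ hμ.ne', Real.rpow_one]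
  have hinv' : ∀ u : ℝ, 0 < u → (u ^ (-μ⁻¹)) ^ (-μ) = u := fun u hu => by
    rw [← Real.rpow_mul hu.le, neg_mul_neg, inv_mul_cancel₀ hμ.ne', Real.rpow_one]
  have hge : ∀ u ∈ I, t₁ ≤ u ^ (-μ⁻¹) := fun u hu => by
    rw [← hinv t₁ ht₁]
    exact Real.rpow_le_rpow_of_nonpos hu.1 hu.2 (by simpa using hμ.le)
  set g : ℝ → EuclideanSpace ℝ (Fin N) := fun u => f (u ^ (-μ⁻¹))
  have hanti : AntitoneOn (fun t : ℝ => t ^ (-μ)) (Ici t₁) :=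
    (Real.antitoneOn_rpow_Ioi_of_exponent_nonpos (neg_nonpos.2 hμ.le)).mono fun t ht =>
      ht₁.trans_le ht
  have hmaps : MapsTo (fun t : ℝ => t ^ (-μ)) (Ici t₁) I := fun t ht =>
    ⟨Real.rpow_pos_of_pos (ht₁.trans_le ht) _, hanti self_mem_Ici ht ht⟩
  have hlip : LipschitzOnWith C.toNNReal g I := LipschitzOnWith.of_dist_le_mul fun u hu v hv => by
    simpa only [hinv' u hu.1, hinv' v hv.1, Real.coe_toNNReal C hC.le, Real.dist_eq] using
      hf _ _ (hge u hu) (hge v hv)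
  calc eVariationOn f (Ici t₁)
      = eVariationOn (g ∘ fun t => t ^ (-μ)) (Ici t₁) :=
        eVariationOn.congr fun t ht => by
          simp only [g, Function.comp_apply, hinv t (ht₁.trans_le ht)]
    _ ≤ eVariationOn (g ∘ id) I := eVariationOn.comp_le_of_antitoneOn g _ hanti hmaps
    _ ≤ C.toNNReal * eVariationOn id (Icc 0 (t₁ ^ (-μ))) :=
        (hlip.comp_eVariationOn_le (mapsTo_id I)).trans
          (mul_le_mul_right (eVariationOn.mono _ Ioc_subset_Icc_self) _)
    _ < ⊤ := by
        rw [eVariationOn_id_Icc]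
        exact ENNReal.mul_lt_top ENNReal.coe_lt_top ENNReal.ofReal_lt_top

theorem IsPowerLipschitz.isBounded_image {X : Type*} [PseudoMetricSpace X] {f : ℝ → X} {t₁ μ : ℝ}
    (hf : IsPowerLipschitz t₁ (-μ) f) (ht₁ : 0 < t₁) (hμ : 0 < μ) :
    Bornology.IsBounded (f '' Ici t₁) := by
  obtain ⟨C, hC, hf⟩ := hf
  refine (Metric.isBounded_closedBall (x := f t₁) (r := C * t₁ ^ (-μ))).subset ?_
  rintro _ ⟨t, ht, rfl⟩
  have ht0 : 0 < t := ht₁.trans_le ht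
  rw [Metric.mem_closedBall']
  refine (hf t₁ t le_rfl ht).trans ?_
  gcongr
  exact abs_sub_le_of_nonneg_of_le (by positivity) le_rfl (by positivity)
    (Real.rpow_le_rpow_of_nonpos ht₁ ht (neg_nonpos.2 hμ.le))

theorem IsPowerLipschitz.hasBoxDim_one {N : ℕ} {f : ℝ → EuclideanSpace ℝ (Fin N)} {t₁ μ η : ℝ}
    (hf : IsPowerLipschitz t₁ (-μ) f) (ht₁ : 0 < t₁) (hμ : 0 < μ)
    {π : EuclideanSpace ℝ (Fin N) → ℝ} (hπ : LipschitzWith 1 π) (hη : 0 < η)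
    (himage : Ioc 0 η ⊆ π '' (f '' Ici t₁)) : HasBoxDim (f '' Ici t₁) 1 := by
  have hbdd := hf.isBounded_image ht₁ hμ
  obtain ⟨C, hC, hf⟩ := hf
  have hV := unitBallVolume_pos N
  have hpow : ∀ ε : ℝ, 0 < ε → ε ^ ((N : ℝ) - 1) = ε ^ N / ε := fun ε hε => by
    rw [Real.rpow_sub_one hε.ne', Real.rpow_natCast]
  refine hasBoxDim_of_volume_thickening (c := η * unitBallVolume N / 6)
    (C := (C * t₁ ^ (-μ) + 1) * (unitBallVolume N * 3 ^ N)) hbdd zero_le_one (by positivity) ?_ ?_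
  · filter_upwards [eventually_mem_nhdsWithin] with ε (hε : 0 < ε)
    convert ofReal_le_volume_thickening (k := 1) (C := 2) hπ two_pos
      (fun x r _ => by rw [Real.volume_ball, pow_one]) hε
      (himage.trans (Metric.self_subset_thickening hε _)) (by rw [Real.volume_Ioc]) using 2
    rw [hpow ε hε]
    field_simp
    ring
  · filter_upwards [eventually_mem_nhdsWithin, nhdsWithin_le_nhds (eventually_le_nhds one_pos)]
      with ε (hε : 0 < ε) hε1
    refine (volume_thickening_image_le_of_arc (u := fun t => C * t ^ (-μ)) (L₁ := C * t₁ ^ (-μ))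
      hε (by positivity) (fun s hs => ?_) fun s hs t ht => ?_).trans (ENNReal.ofReal_le_ofReal ?_)
    · have hs0 : 0 < s := ht₁.trans_le hs
      exact ⟨by positivity, mul_le_mul_of_nonneg_left
        (Real.rpow_le_rpow_of_nonpos ht₁ hs (neg_nonpos.2 hμ.le)) hC.le⟩
    · rw [← mul_sub, abs_mul, abs_of_pos hC]
      exact hf s t hs ht
    · calc (C * t₁ ^ (-μ) / ε + 1) * (unitBallVolume N * (3 * ε) ^ N)
          = (C * t₁ ^ (-μ) + ε) * (unitBallVolume N * 3 ^ N) * (ε ^ N / ε) := by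
            field_simp
            ring
        _ ≤ _ := by rw [hpow ε hε]; gcongr

end FiniteLength

/-! ### Power-law bounds -/

section PowerLaw

theorem isBigO_rpow_rpow_of_le {t₁ a b : ℝ} (ht₁ : 0 < t₁) (h : a ≤ b) :
    (fun t : ℝ => t ^ a) =O[𝓟 (Ici t₁)] fun t => t ^ b := by
  refine isBigO_principal.2 ⟨t₁ ^ (a - b), fun t ht => ?_⟩
  have ht0 : 0 < t := ht₁.trans_le ht
  rw [Real.norm_of_nonneg (by positivity), Real.norm_of_nonneg (by positivity)]
  calc t ^ a = t ^ (a - b) * t ^ b := by rw [← Real.rpow_add ht0, sub_add_cancel]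
    _ ≤ t₁ ^ (a - b) * t ^ b := by
        gcongr ?_ * _
        exact Real.rpow_le_rpow_of_nonpos ht₁ ht (sub_nonpos.2 h)

theorem isBigO_mul_rpow {l : Filter ℝ} {f g : ℝ → ℝ} {a b c : ℝ} (hl : ∀ᶠ t in l, 0 < t)
    (hf : f =O[l] fun t => t ^ a) (hg : g =O[l] fun t => t ^ b) (h : a + b = c) :
    (fun t => f t * g t) =O[l] fun t => t ^ c :=
  (hf.mul hg).congr' EventuallyEq.rfl <| by
    filter_upwards [hl] with t ht
    rw [← Real.rpow_add ht, h]

theorem isBigO_principal_Ici {f g : ℝ → ℝ} {a : ℝ} (h : f =O[atTop] g)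
    (hf : ContinuousOn f (Ici a)) (hg : ContinuousOn g (Ici a)) (hg₀ : ∀ t, a ≤ t → g t ≠ 0) :
    f =O[𝓟 (Ici a)] g := by
  obtain ⟨c, hc⟩ := h.bound
  obtain ⟨T, hT⟩ := eventually_atTop.1 hc
  have hhead : f =O[𝓟 (Icc a T)] g :=
    ((hf.mono Icc_subset_Ici_self).isBigO_principal isCompact_Icc (c := (1 : ℝ)) (by simp)).trans
      ((hg.mono Icc_subset_Ici_self).isBigO_rev_principal isCompact_Icc
        (fun t ht => hg₀ t ht.1) 1)
  have htail : f =O[𝓟 (Ici T)] g := isBigO_principal.2 ⟨c, hT⟩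
  refine (hhead.sup htail).mono ?_
  rw [sup_principal, principal_mono]
  exact Ici_subset_Icc_union_Ici

theorem norm_sub_le_of_norm_deriv_le {E : Type*} [NormedAddCommGroup E] [NormedSpace ℝ E]
    {f f' : ℝ → E} {B B' : ℝ → ℝ} {a s t : ℝ}
    (hf : ∀ t, a ≤ t → HasDerivWithinAt f (f' t) (Ici a) t)
    (hB : ∀ t, a ≤ t → HasDerivWithinAt B (B' t) (Ici a) t)
    (h : ∀ t, a ≤ t → ‖f' t‖ ≤ B' t) (hs : a ≤ s) (hst : s ≤ t) : ‖f t - f s‖ ≤ B t - B s := by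
  have hsub : Icc s t ⊆ Ici a := fun x hx => hs.trans hx.1
  refine image_norm_le_of_norm_deriv_right_le_deriv_boundary' (f := fun x => f x - f s)
    (B := fun x => B x - B s) (f' := f') (B' := B') ?_ ?_ (by simp) ?_ ?_ ?_
    (right_mem_Icc.2 hst)
  · exact fun x hx => ((hf x (hsub hx)).continuousWithinAt.mono hsub).sub_const _
  · exact fun x hx => ((hf x (hs.trans hx.1)).mono (Ici_subset_Ici.2 (hs.trans hx.1))).sub_const _
  · exact fun x hx => ((hB x (hsub hx)).continuousWithinAt.mono hsub).sub_const _
  · exact fun x hx => ((hB x (hs.trans hx.1)).mono (Ici_subset_Ici.2 (hs.trans hx.1))).sub_const _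
  · exact fun x hx => h x (hs.trans hx.1)

theorem hasDerivWithinAt_rpow_div {t₁ β t : ℝ} (ht₁ : 0 < t₁) (hβ : β ≠ 0) (C : ℝ)
    (ht : t₁ ≤ t) :
    HasDerivWithinAt (fun t : ℝ => C / β * t ^ β) (C * t ^ (β - 1)) (Ici t₁) t := by
  convert! ((Real.hasDerivAt_rpow_const (p := β) (Or.inl (ht₁.trans_le ht).ne')).const_mul
    (C / β)).hasDerivWithinAt using 1
  field_simp

theorem isPowerLipschitz_of_hasDerivWithinAt {E : Type*} [NormedAddCommGroup E] [NormedSpace ℝ E]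
    {f f' : ℝ → E} {t₁ β : ℝ} (ht₁ : 0 < t₁) (hβ : β ≠ 0)
    (hf : ∀ t, t₁ ≤ t → HasDerivWithinAt f (f' t) (Ici t₁) t)
    (hf' : f' =O[𝓟 (Ici t₁)] fun t => t ^ (β - 1)) : IsPowerLipschitz t₁ β f := by
  obtain ⟨C, hC, hf'⟩ := hf'.exists_pos
  rw [isBigOWith_principal] at hf'
  refine ⟨C / |β|, by positivity, fun s t hs ht => ?_⟩
  wlog hst : s ≤ t generalizing s t
  · rw [dist_comm, abs_sub_comm]
    exact this t s ht hs (le_of_not_ge hst)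
  rw [dist_comm, dist_eq_norm]
  calc ‖f t - f s‖ ≤ C / β * t ^ β - C / β * s ^ β :=
        norm_sub_le_of_norm_deriv_le hf (fun u hu => hasDerivWithinAt_rpow_div ht₁ hβ C hu)
          (fun u hu => (hf' u hu).trans_eq <| by
            rw [Real.norm_of_nonneg (Real.rpow_nonneg (ht₁.trans_le hu).le _)]) hs hst
    _ ≤ |C / β * t ^ β - C / β * s ^ β| := le_abs_self _
    _ = C / |β| * |s ^ β - t ^ β| := by
        rw [← mul_sub, abs_mul, abs_div, abs_of_pos hC, abs_sub_comm]

end PowerLaw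

section Coordinates

theorem dist_le_sum_abs {N : ℕ} (v w : EuclideanSpace ℝ (Fin N)) :
    dist v w ≤ ∑ i, |v i - w i| := by
  rw [EuclideanSpace.dist_eq]
  refine Real.sqrt_le_iff.2 ⟨Finset.sum_nonneg fun i _ => abs_nonneg _, ?_⟩
  simp only [Real.dist_eq]
  exact Finset.sum_sq_le_sq_sum_of_nonneg fun i _ => abs_nonneg _

variable {N : ℕ} {f : ℝ → EuclideanSpace ℝ (Fin N)} {t₁ α β m : ℝ} {ang : ℝ → ℝ}

theorem isPowerLipschitz_of_apply [NeZero N]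
    (hf : ∀ i, IsPowerLipschitz t₁ β fun t => f t i) : IsPowerLipschitz t₁ β f := by
  choose C hC hf using hf
  refine ⟨∑ i, C i, Finset.sum_pos (fun i _ => hC i) Finset.univ_nonempty, fun s t hs ht => ?_⟩
  rw [Finset.sum_mul]
  exact (dist_le_sum_abs _ _).trans (Finset.sum_le_sum fun i _ => hf i s t hs ht)

theorem isPowerLipschitzModAngle_of_apply [NeZero N]
    (hf : ∀ i, IsPowerLipschitzModAngle t₁ α m ang fun t => f t i) :
    IsPowerLipschitzModAngle t₁ α m ang f := by
  choose C hC hf using hf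
  refine ⟨∑ i, C i, Finset.sum_pos (fun i _ => hC i) Finset.univ_nonempty,
    fun T s t hT hs ht => ?_⟩
  rw [Finset.sum_mul, Finset.sum_mul, Finset.sum_mul, ← Finset.sum_add_distrib]
  exact (dist_le_sum_abs _ _).trans (Finset.sum_le_sum fun i _ => hf i T s t hT hs ht)

theorem IsPowerLipschitz.modAngle {X : Type*} [PseudoMetricSpace X] {f : ℝ → X}
    (hf : IsPowerLipschitz t₁ (-m) f) (ht₁ : 0 < t₁) (α : ℝ) (ang : ℝ → ℝ) :
    IsPowerLipschitzModAngle t₁ α m ang f := by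
  obtain ⟨C, hC, hf⟩ := hf
  refine ⟨C, hC, fun T s t hT hs ht => (hf s t (hT.trans hs) (hT.trans ht)).trans ?_⟩
  have hT0 : 0 < T := ht₁.trans_le hT
  exact le_add_of_nonneg_right (by positivity)

theorem IsPowerLipschitzModAngle.add {f g : ℝ → ℝ} (hf : IsPowerLipschitzModAngle t₁ α m ang f)
    (hg : IsPowerLipschitzModAngle t₁ α m ang g) :
    IsPowerLipschitzModAngle t₁ α m ang fun t => f t + g t := by
  obtain ⟨C, hC, hf⟩ := hf
  obtain ⟨C', hC', hg⟩ := hg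
  refine ⟨C + C', by positivity, fun T s t hT hs ht => (dist_add_add_le _ _ _ _).trans ?_⟩
  linarith [hf T s t hT hs ht, hg T s t hT hs ht]

theorem isPowerLipschitzModAngle_mul {a g : ℝ → ℝ} (ha : IsPowerLipschitz t₁ (-m) a)
    (ha' : a =O[𝓟 (Ici t₁)] fun t => t ^ (-α)) (ht₁ : 0 < t₁) (hα : 0 ≤ α)
    (hg : LipschitzWith 1 g) (hg₁ : ∀ θ, |g θ| ≤ 1) :
    IsPowerLipschitzModAngle t₁ α m ang fun t => a t * g (ang t) := by
  obtain ⟨C, hC, ha⟩ := ha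
  obtain ⟨C', hC', ha'⟩ := ha'.exists_pos
  rw [isBigOWith_principal] at ha'
  refine ⟨C + C', by positivity, fun T s t hT hs ht => ?_⟩
  have hT0 : 0 < T := ht₁.trans_le hT
  have hamp : |a t| ≤ C' * T ^ (-α) := by
    have ht0 : 0 < t := hT0.trans_le ht
    have h := ha' t (hT.trans ht)
    rw [Real.norm_eq_abs, Real.norm_of_nonneg (by positivity)] at h
    refine h.trans ?_
    gcongr ?_ * ?_
    exact Real.rpow_le_rpow_of_nonpos hT0 ht (neg_nonpos.2 hα)
  have hincr : |a s - a t| ≤ C * |s ^ (-m) - t ^ (-m)| := ha s t (hT.trans hs) (hT.trans ht)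
  have hlip : |g (ang s) - g (ang t)| ≤ |ang s - ang t| := by
    simpa only [Real.dist_eq, NNReal.coe_one, one_mul] using hg.dist_le_mul (ang s) (ang t)
  calc dist (a s * g (ang s)) (a t * g (ang t))
      = |(a s - a t) * g (ang s) + a t * (g (ang s) - g (ang t))| := by
        rw [Real.dist_eq]; ring_nf
    _ ≤ |a s - a t| * |g (ang s)| + |a t| * |g (ang s) - g (ang t)| := by
        rw [← abs_mul, ← abs_mul]
        exact abs_add_le _ _
    _ ≤ C * |s ^ (-m) - t ^ (-m)| * 1 + C' * T ^ (-α) * |ang s - ang t| := by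
        gcongr
        exact hg₁ _
    _ ≤ (C + C') * |s ^ (-m) - t ^ (-m)| + (C + C') * T ^ (-α) * |ang s - ang t| := by
        rw [mul_one]
        gcongr <;> linarith

end Coordinates

section DerivWithin

theorem D_zero (t₀ : ℝ) (f : ℝ → ℝ) : D t₀ 0 f = f := by
  funext t
  simp only [D, iteratedDerivWithin_zero]

theorem hasDerivWithinAt_D {t₀ : ℝ} {n : ℕ} {f : ℝ → ℝ} (hf : ContDiffOn ℝ n f (Ici t₀)) {j : ℕ}
    (hj : j < n) (t : ℝ) (ht : t₀ ≤ t) :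
    HasDerivWithinAt (D t₀ j f) (D t₀ (j + 1) f t) (Ici t₀) t := by
  unfold D
  rw [iteratedDerivWithin_succ]
  exact (hf.differentiableOn_iteratedDerivWithin (by exact_mod_cast hj)
    (uniqueDiffOn_Ici t₀) t ht).hasDerivWithinAt

theorem continuousOn_D {t₀ : ℝ} {n : ℕ} {f : ℝ → ℝ} (hf : ContDiffOn ℝ n f (Ici t₀)) {j : ℕ}
    (hj : j ≤ n) : ContinuousOn (D t₀ j f) (Ici t₀) :=
  hf.continuousOn_iteratedDerivWithin (by exact_mod_cast hj) (uniqueDiffOn_Ici t₀)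

theorem ComparableInLimit.isEquivalent {t₀ c α : ℝ} {k j : ℕ} {f : ℝ → ℝ}
    (hf : ComparableInLimit t₀ k c α f) (hj : j ≤ k) :
    D t₀ j f ~[atTop] fun t =>
      (-1) ^ j * (∏ i ∈ Finset.range j, (α + (i : ℝ))) * c * t ^ (-α - (j : ℝ)) :=
  isEquivalent_of_tendsto_one (hf.2 j hj)

theorem continuousOn_rpow_Ici {t₀ : ℝ} (ht₀ : 0 < t₀) (a : ℝ) :
    ContinuousOn (fun t : ℝ => t ^ a) (Ici t₀) :=
  continuousOn_id.rpow_const fun _ ht => Or.inl (ht₀.trans_le ht).ne'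

theorem ComparableInLimit.isBigO {t₀ c α : ℝ} {k j : ℕ} {f : ℝ → ℝ}
    (hf : ComparableInLimit t₀ k c α f) (hj : j ≤ k) (ht₀ : 0 < t₀) :
    D t₀ j f =O[𝓟 (Ici t₀)] fun t => t ^ (-α - (j : ℝ)) :=
  isBigO_principal_Ici ((hf.isEquivalent hj).isBigO.trans (isBigO_const_mul_self _ _ _))
    (continuousOn_D hf.1 hj) (continuousOn_rpow_Ici ht₀ _)
    fun _ ht => (Real.rpow_pos_of_pos (ht₀.trans_le ht) _).ne'

theorem ComparableInLimit.tendsto_deriv {t₀ K : ℝ} {k : ℕ} {q : ℝ → ℝ}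
    (hq : ComparableInLimit t₀ k K (-1) q) (hk : 1 ≤ k) : Tendsto (D t₀ 1 q) atTop (𝓝 K) := by
  refine (hq.isEquivalent hk).symm.tendsto_nhds (tendsto_const_nhds.congr fun t => ?_)
  simp

theorem pos_of_ne_zero_of_eventually_pos {a : ℝ} {g : ℝ → ℝ} (hg : ContinuousOn g (Ici a))
    (hne : ∀ t, a ≤ t → g t ≠ 0) (h : ∀ᶠ t in atTop, 0 < g t) (t : ℝ) (ht : a ≤ t) : 0 < g t := by
  by_contra! hle
  obtain ⟨T, hT, haT⟩ := (h.and (eventually_ge_atTop a)).exists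
  obtain ⟨s, hs, hs₀⟩ := isPreconnected_Ici.intermediate_value ht haT hg ⟨hle, hT.le⟩
  exact hne s hs hs₀

theorem IsPowerLipschitz.isBigO_sub_of_tendsto {E : Type*} [NormedAddCommGroup E] {f : ℝ → E}
    {t₁ μ : ℝ} {L : E} (hf : IsPowerLipschitz t₁ (-μ) f) (ht₁ : 0 < t₁) (hμ : 0 < μ)
    (hlim : Tendsto f atTop (𝓝 L)) : (fun t => f t - L) =O[𝓟 (Ici t₁)] fun t => t ^ (-μ) := by
  obtain ⟨C, hC, hf⟩ := hf
  refine isBigO_principal.2 ⟨C, fun t ht => ?_⟩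
  have ht0 : 0 < t := ht₁.trans_le ht
  rw [← dist_eq_norm, Real.norm_of_nonneg (by positivity)]
  refine le_of_tendsto (tendsto_const_nhds.dist hlim) ?_
  filter_upwards [eventually_ge_atTop t] with s hs
  refine (hf t s ht (ht.trans hs)).trans ?_
  have hs0 : 0 < s := ht0.trans_le hs
  gcongr
  exact abs_sub_le_of_nonneg_of_le (by positivity) le_rfl (by positivity)
    (Real.rpow_le_rpow_of_nonpos ht0 hs (neg_nonpos.2 hμ.le))

end DerivWithin

/-! ### Amplitude and phase -/

/-- The quantitative properties of the amplitude `p` and the phase `q` on which the analysis of the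
solutions `A p sin (q + θ)` rests. -/
structure AmplitudePhase (t₀ α K : ℝ) (p q : ℝ → ℝ) : Prop where
  t₀_pos : 0 < t₀
  α_pos : 0 < α
  K_pos : 0 < K
  p_pos : ∀ t, t₀ ≤ t → 0 < p t
  q'_pos : ∀ t, t₀ ≤ t → 0 < D t₀ 1 q t
  hasDeriv_p : ∀ t, t₀ ≤ t → HasDerivWithinAt p (D t₀ 1 p t) (Ici t₀) t
  hasDeriv_p' : ∀ t, t₀ ≤ t → HasDerivWithinAt (D t₀ 1 p) (D t₀ 2 p t) (Ici t₀) t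
  hasDeriv_q : ∀ t, t₀ ≤ t → HasDerivWithinAt q (D t₀ 1 q t) (Ici t₀) t
  hasDeriv_q' : ∀ t, t₀ ≤ t → HasDerivWithinAt (D t₀ 1 q) (D t₀ 2 q t) (Ici t₀) t
  continuousOn_p'' : ContinuousOn (D t₀ 2 p) (Ici t₀)
  continuousOn_q'' : ContinuousOn (D t₀ 2 q) (Ici t₀)
  isBigO_p : p =O[𝓟 (Ici t₀)] fun t => t ^ (-α)
  isBigO_rpow : (fun t => t ^ (-α)) =O[𝓟 (Ici t₀)] p
  isBigO_p' : D t₀ 1 p =O[𝓟 (Ici t₀)] fun t => t ^ (-α - 1)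
  isBigO_p'' : D t₀ 2 p =O[𝓟 (Ici t₀)] fun t => t ^ (-α - 2)
  isBigO_q'_sub : (fun t => D t₀ 1 q t - K) =O[𝓟 (Ici t₀)] fun t => t ^ (-1 : ℝ)
  isBigO_q'' : D t₀ 2 q =O[𝓟 (Ici t₀)] fun t => t ^ (-2 : ℝ)
  isBigO_one_q' : (fun _ => (1 : ℝ)) =O[𝓟 (Ici t₀)] D t₀ 1 q
  eventually_p'_le : ∃ c, 0 < c ∧ ∀ᶠ t in atTop, D t₀ 1 p t ≤ -c * t ^ (-α - 1)

section

variable {t₀ α K : ℝ} {p q : ℝ → ℝ}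

theorem ComparableInLimit.eventually_deriv_le (hp : ComparableInLimit t₀ 2 1 α p) (hα : 0 < α) :
    ∀ᶠ t in atTop, D t₀ 1 p t ≤ -(α / 2) * t ^ (-α - 1) := by
  have hlim : Tendsto (fun t => D t₀ 1 p t / (-α * t ^ (-α - 1))) atTop (𝓝 1) := by
    simpa using hp.2 1 one_le_two
  filter_upwards [hlim.eventually (lt_mem_nhds one_half_lt_one), eventually_gt_atTop 0]
    with t ht ht0
  have hpow := Real.rpow_pos_of_pos ht0 (-α - 1)
  rw [lt_div_iff_of_neg (by nlinarith)] at ht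
  linarith

theorem amplitudePhase_of_comparableInLimit (ht₀ : 0 < t₀) (hα : 0 < α) (hK : 0 < K)
    (hq_smooth : ContDiffOn ℝ 2 q (Ici t₀)) (hp_ne : ∀ t, t₀ ≤ t → p t ≠ 0)
    (hq_ne : ∀ t, t₀ ≤ t → D t₀ 1 q t ≠ 0) (hp : ComparableInLimit t₀ 2 1 α p)
    (hq : Tendsto (D t₀ 1 q) atTop (𝓝 K))
    (hq2 : D t₀ 2 q =O[atTop] fun t : ℝ => t ^ (-2 : ℝ)) : AmplitudePhase t₀ α K p q := by
  have hpow_ne : ∀ a t : ℝ, t₀ ≤ t → t ^ a ≠ 0 := fun a t ht =>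
    (Real.rpow_pos_of_pos (ht₀.trans_le ht) a).ne'
  have hp_cont : ContinuousOn p (Ici t₀) := hp.1.continuousOn
  have hp_equiv : p ~[atTop] fun t => t ^ (-α) := by
    simpa [D_zero] using hp.isEquivalent zero_le_two
  have hq'' : D t₀ 2 q =O[𝓟 (Ici t₀)] fun t => t ^ (-2 : ℝ) :=
    isBigO_principal_Ici hq2 (continuousOn_D hq_smooth le_rfl) (continuousOn_rpow_Ici ht₀ _)
      (hpow_ne _)
  have hdq' : ∀ t, t₀ ≤ t → HasDerivWithinAt (D t₀ 1 q) (D t₀ 2 q t) (Ici t₀) t :=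
    hasDerivWithinAt_D hq_smooth (by norm_num)
  exact
    { t₀_pos := ht₀
      α_pos := hα
      K_pos := hK
      p_pos := pos_of_ne_zero_of_eventually_pos hp_cont hp_ne <| by
        obtain ⟨u, hu, hpu⟩ := hp_equiv.exists_eq_mul
        filter_upwards [hpu, hu.eventually (lt_mem_nhds one_pos), eventually_gt_atTop 0]
          with t ht hut ht0
        rw [ht]
        exact mul_pos hut (Real.rpow_pos_of_pos ht0 _)
      q'_pos := pos_of_ne_zero_of_eventually_pos (continuousOn_D hq_smooth one_le_two) hq_ne
        (hq.eventually (lt_mem_nhds hK))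
      hasDeriv_p := by simpa only [D_zero] using hasDerivWithinAt_D hp.1 two_pos
      hasDeriv_p' := hasDerivWithinAt_D hp.1 one_lt_two
      hasDeriv_q := by simpa only [D_zero] using hasDerivWithinAt_D (n := 2) hq_smooth two_pos
      hasDeriv_q' := hdq'
      continuousOn_p'' := continuousOn_D hp.1 le_rfl
      continuousOn_q'' := continuousOn_D hq_smooth le_rfl
      isBigO_p := by simpa [D_zero] using hp.isBigO zero_le_two ht₀
      isBigO_rpow := isBigO_principal_Ici hp_equiv.isBigO_symm (continuousOn_rpow_Ici ht₀ _)
        hp_cont hp_ne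
      isBigO_p' := by simpa using hp.isBigO one_le_two ht₀
      isBigO_p'' := by simpa using hp.isBigO le_rfl ht₀
      isBigO_q'_sub := (isPowerLipschitz_of_hasDerivWithinAt ht₀ (by norm_num) hdq'
        (by norm_num1; exact hq'')).isBigO_sub_of_tendsto ht₀ one_pos hq
      isBigO_q'' := hq''
      isBigO_one_q' := isBigO_principal_Ici
        ((isBigO_const_const 1 hK.ne' _).trans
          ((isEquivalent_const_iff_tendsto hK.ne').2 hq).isBigO_symm) continuousOn_const
        (continuousOn_D hq_smooth one_le_two) hq_ne
      eventually_p'_le := ⟨α / 2, by positivity, hp.eventually_deriv_le hα⟩ }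

theorem tendsto_zero_of_isBigO {f : ℝ → ℝ} {a b : ℝ} (hf : f =O[𝓟 (Ici a)] fun t => t ^ (-b))
    (hb : 0 < b) : Tendsto f atTop (𝓝 0) :=
  (hf.mono (le_principal_iff.2 (Ici_mem_atTop a))).trans_tendsto (tendsto_rpow_neg_atTop hb)

namespace AmplitudePhase

theorem eventually_pos (h : AmplitudePhase t₀ α K p q) : ∀ᶠ t in 𝓟 (Ici t₀), 0 < t :=
  eventually_principal.2 fun _ ht => h.t₀_pos.trans_le ht

theorem isBigO_inv_p (h : AmplitudePhase t₀ α K p q) :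
    (fun t => (p t)⁻¹) =O[𝓟 (Ici t₀)] fun t => t ^ α := by
  refine (h.isBigO_rpow.inv_rev ?_).congr' EventuallyEq.rfl ?_ <;>
    filter_upwards [h.eventually_pos] with t ht
  · exact fun h0 => absurd h0 (Real.rpow_pos_of_pos ht _).ne'
  · rw [Real.rpow_neg ht.le, inv_inv]

theorem isBigO_inv_q' (h : AmplitudePhase t₀ α K p q) :
    (fun t => (D t₀ 1 q t)⁻¹) =O[𝓟 (Ici t₀)] fun _ => (1 : ℝ) := by
  simpa using h.isBigO_one_q'.inv_rev (by simp)

theorem isBigO_p'_div (h : AmplitudePhase t₀ α K p q) :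
    (fun t => D t₀ 1 p t / p t) =O[𝓟 (Ici t₀)] fun t => t ^ (-1 : ℝ) := by
  simpa only [div_eq_mul_inv] using
    isBigO_mul_rpow h.eventually_pos h.isBigO_p' h.isBigO_inv_p (by ring)

theorem isBigO_p''_div (h : AmplitudePhase t₀ α K p q) :
    (fun t => D t₀ 2 p t / p t) =O[𝓟 (Ici t₀)] fun t => t ^ (-2 : ℝ) := by
  simpa only [div_eq_mul_inv] using
    isBigO_mul_rpow h.eventually_pos h.isBigO_p'' h.isBigO_inv_p (by ring)

theorem isBigO_p'_div_sq (h : AmplitudePhase t₀ α K p q) :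
    (fun t => (D t₀ 1 p t / p t) ^ 2) =O[𝓟 (Ici t₀)] fun t => t ^ (-2 : ℝ) := by
  simpa only [sq] using
    isBigO_mul_rpow h.eventually_pos h.isBigO_p'_div h.isBigO_p'_div (by norm_num)

theorem isBigO_q''_div (h : AmplitudePhase t₀ α K p q) :
    (fun t => D t₀ 2 q t / D t₀ 1 q t) =O[𝓟 (Ici t₀)] fun t => t ^ (-2 : ℝ) := by
  simpa [div_eq_mul_inv] using h.isBigO_q''.mul h.isBigO_inv_q'

theorem isBigO_dampingCoeff (h : AmplitudePhase t₀ α K p q) :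
    dampingCoeff t₀ p q =O[𝓟 (Ici t₀)] fun t => t ^ (-1 : ℝ) := by
  refine ((h.isBigO_p'_div.const_mul_left 2).add (h.isBigO_q''_div.trans
    (isBigO_rpow_rpow_of_le h.t₀_pos (by norm_num)))).congr_left fun t => ?_
  rw [dampingCoeff, mul_div_assoc]

theorem isBigO_restoringCoeff_sub (h : AmplitudePhase t₀ α K p q) :
    (fun t => restoringCoeff t₀ p q t - D t₀ 1 q t ^ 2) =O[𝓟 (Ici t₀)] fun t => t ^ (-2 : ℝ) := by
  have hmixed : (fun t => D t₀ 1 p t / p t * (D t₀ 2 q t / D t₀ 1 q t))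
      =O[𝓟 (Ici t₀)] fun t => t ^ (-2 : ℝ) :=
    (isBigO_mul_rpow h.eventually_pos h.isBigO_p'_div h.isBigO_q''_div rfl).trans
      (isBigO_rpow_rpow_of_le h.t₀_pos (by norm_num))
  refine (((h.isBigO_p'_div_sq.const_mul_left 2).sub h.isBigO_p''_div).add hmixed).congr_left
    fun t => ?_
  rw [restoringCoeff, div_pow, mul_div_assoc, div_mul_div_comm]
  ring

theorem tendsto_q' (h : AmplitudePhase t₀ α K p q) : Tendsto (D t₀ 1 q) atTop (𝓝 K) :=
  tendsto_sub_nhds_zero_iff.1 (tendsto_zero_of_isBigO h.isBigO_q'_sub one_pos)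

theorem tendsto_dampingCoeff (h : AmplitudePhase t₀ α K p q) :
    Tendsto (dampingCoeff t₀ p q) atTop (𝓝 0) :=
  tendsto_zero_of_isBigO h.isBigO_dampingCoeff one_pos

theorem tendsto_restoringCoeff (h : AmplitudePhase t₀ α K p q) :
    Tendsto (restoringCoeff t₀ p q) atTop (𝓝 (K ^ 2)) := by
  simpa using (tendsto_zero_of_isBigO h.isBigO_restoringCoeff_sub two_pos).add (h.tendsto_q'.pow 2)

theorem isBigO_q' (h : AmplitudePhase t₀ α K p q) :
    D t₀ 1 q =O[𝓟 (Ici t₀)] fun _ => (1 : ℝ) := by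
  have hconst : (fun _ => K) =O[𝓟 (Ici t₀)] fun _ => (1 : ℝ) := isBigO_const_const _ one_ne_zero _
  have hsub : (fun t => D t₀ 1 q t - K) =O[𝓟 (Ici t₀)] fun _ => (1 : ℝ) := by
    simpa using h.isBigO_q'_sub.trans
      (isBigO_rpow_rpow_of_le h.t₀_pos (show (-1 : ℝ) ≤ 0 by norm_num))
  simpa using hsub.add hconst

theorem isBigO_dampingCoeff_one (h : AmplitudePhase t₀ α K p q) :
    dampingCoeff t₀ p q =O[𝓟 (Ici t₀)] fun _ => (1 : ℝ) := by
  simpa using h.isBigO_dampingCoeff.trans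
    (isBigO_rpow_rpow_of_le h.t₀_pos (show (-1 : ℝ) ≤ 0 by norm_num))

theorem isBigO_restoringCoeff_one (h : AmplitudePhase t₀ α K p q) :
    restoringCoeff t₀ p q =O[𝓟 (Ici t₀)] fun _ => (1 : ℝ) := by
  have hsub : (fun t => restoringCoeff t₀ p q t - D t₀ 1 q t ^ 2)
      =O[𝓟 (Ici t₀)] fun _ => (1 : ℝ) := by
    simpa using h.isBigO_restoringCoeff_sub.trans
      (isBigO_rpow_rpow_of_le h.t₀_pos (show (-2 : ℝ) ≤ 0 by norm_num))
  have hsq : (fun t => D t₀ 1 q t ^ 2) =O[𝓟 (Ici t₀)] fun _ => (1 : ℝ) := by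
    simpa using h.isBigO_q'.pow 2
  simpa using hsub.add hsq

end AmplitudePhase

/-! ### The normal form of the equation -/

/-- `(x, y)` solves `x' = y`, `y' = -b x + a y` on `[t₁, ∞)`, the first-order form of the
second-order equation. Trajectories of the spatial system have this form in the time variable
`γ z^{-1/γ}`, on a half-line that may start after `t₀`. -/
structure IsPlanarSolution (t₀ : ℝ) (p q : ℝ → ℝ) (t₁ : ℝ) (x y : ℝ → ℝ) : Prop where
  le : t₀ ≤ t₁
  x_deriv : ∀ t, t₁ ≤ t → HasDerivWithinAt x (y t) (Ici t₁) t
  y_deriv : ∀ t, t₁ ≤ t →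
    HasDerivWithinAt y (-restoringCoeff t₀ p q t * x t + dampingCoeff t₀ p q t * y t) (Ici t₁) t

theorem exists_eq_mul_sin_cos {ξ η q q' : ℝ → ℝ} {t₁ : ℝ}
    (hq : ∀ t, t₁ ≤ t → HasDerivWithinAt q (q' t) (Ici t₁) t)
    (hξ : ∀ t, t₁ ≤ t → HasDerivWithinAt ξ (q' t * η t) (Ici t₁) t)
    (hη : ∀ t, t₁ ≤ t → HasDerivWithinAt η (-q' t * ξ t) (Ici t₁) t) :
    ∃ A θ : ℝ, 0 ≤ A ∧ ∀ t, t₁ ≤ t →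
      ξ t = A * Real.sin (q t + θ) ∧ η t = A * Real.cos (q t + θ) := by
  set w : ℝ → ℂ := fun t => (η t + ξ t * Complex.I) * Complex.exp (-(q t * Complex.I)) with hw
  have hw' : ∀ t, t₁ ≤ t → HasDerivWithinAt w 0 (Ici t₁) t := by
    intro t ht
    convert! ((hη t ht).ofReal_comp.add ((hξ t ht).ofReal_comp.mul_const Complex.I)).mul
      ((hq t ht).ofReal_comp.mul_const Complex.I).neg.cexp using 1
    simp only [Pi.add_apply]
    push_cast
    linear_combination (q' t * ξ t * Complex.exp (-(q t * Complex.I))) * Complex.I_sq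
  refine ⟨‖w t₁‖, Complex.arg (w t₁), norm_nonneg _, fun t ht => ?_⟩
  have hconst : w t = w t₁ := by
    rw [← sub_eq_zero, ← norm_le_zero_iff]
    simpa using norm_sub_le_of_norm_deriv_le (B := 0) (B' := 0) hw'
      (fun t _ => hasDerivWithinAt_const t _ 0) (by simp) le_rfl ht
  have hpolar : (η t : ℂ) + ξ t * Complex.I
      = ‖w t₁‖ * Complex.exp ((q t + Complex.arg (w t₁) : ℝ) * Complex.I) :=
    calc (η t : ℂ) + ξ t * Complex.I = w t * Complex.exp (q t * Complex.I) := by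
          simp only [hw, mul_assoc, ← Complex.exp_add]; simp
      _ = ‖w t₁‖ * Complex.exp (Complex.arg (w t₁) * Complex.I) *
          Complex.exp (q t * Complex.I) := by
          rw [hconst, Complex.norm_mul_exp_arg_mul_I]
      _ = _ := by rw [mul_assoc, ← Complex.exp_add]; push_cast; ring_nf
  have hre := congrArg Complex.re hpolar
  have him := congrArg Complex.im hpolar
  rw [Complex.re_ofReal_mul, Complex.exp_ofReal_mul_I_re] at hre
  rw [Complex.im_ofReal_mul, Complex.exp_ofReal_mul_I_im] at him
  exact ⟨by simpa using him, by simpa using hre⟩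

/-- The first coordinate `x / p` of the phase point `(x, y)` at time `t` in the frame in which the
solutions rotate with angular velocity `q'` about the origin. -/
def normalPos (p : ℝ → ℝ) (x t : ℝ) : ℝ := x / p t

/-- The second coordinate of the phase point `(x, y)` at time `t` in the frame in which the
solutions rotate: the value of `(x / p)' / q'` along a solution through `(x, y)`. -/
def normalVel (t₀ : ℝ) (p q : ℝ → ℝ) (x y t : ℝ) : ℝ :=
  (y * p t - x * D t₀ 1 p t) / (p t ^ 2 * D t₀ 1 q t)

section NormalForm

variable {t₁ : ℝ} {x y : ℝ → ℝ} (h : AmplitudePhase t₀ α K p q)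
  (hxy : IsPlanarSolution t₀ p q t₁ x y)
include h hxy

theorem IsPlanarSolution.hasDerivWithinAt_normalPos (t : ℝ) (ht : t₁ ≤ t) :
    HasDerivWithinAt (fun t => normalPos p (x t) t)
      (D t₀ 1 q t * normalVel t₀ p q (x t) (y t) t) (Ici t₁) t := by
  have ht' := hxy.le.trans ht
  have hp := (h.p_pos t ht').ne'
  have hq := (h.q'_pos t ht').ne'
  convert! (hxy.x_deriv t ht).div ((h.hasDeriv_p t ht').mono (Ici_subset_Ici.2 hxy.le)) hp using 1
  rw [normalVel]
  field_simp

theorem IsPlanarSolution.hasDerivWithinAt_normalVel (t : ℝ) (ht : t₁ ≤ t) :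
    HasDerivWithinAt (fun t => normalVel t₀ p q (x t) (y t) t)
      (-D t₀ 1 q t * normalPos p (x t) t) (Ici t₁) t := by
  have ht' := hxy.le.trans ht
  have hp := (h.p_pos t ht').ne'
  have hq := (h.q'_pos t ht').ne'
  have hp₁ := (h.hasDeriv_p t ht').mono (Ici_subset_Ici.2 hxy.le)
  have hp₂ := (h.hasDeriv_p' t ht').mono (Ici_subset_Ici.2 hxy.le)
  have hq₂ := (h.hasDeriv_q' t ht').mono (Ici_subset_Ici.2 hxy.le)
  convert! (((hxy.y_deriv t ht).mul hp₁).sub ((hxy.x_deriv t ht).mul hp₂)).div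
    ((hp₁.pow 2).mul hq₂) (mul_ne_zero (pow_ne_zero 2 hp) hq) using 1
  simp only [normalPos, dampingCoeff, restoringCoeff, Pi.mul_apply, Pi.sub_apply, Pi.pow_apply]
  field_simp
  ring

theorem IsPlanarSolution.exists_normalForm : ∃ A θ : ℝ, 0 ≤ A ∧ ∀ t, t₁ ≤ t →
    normalPos p (x t) t = A * Real.sin (q t + θ) ∧
      normalVel t₀ p q (x t) (y t) t = A * Real.cos (q t + θ) :=
  exists_eq_mul_sin_cos
    (fun t ht => (h.hasDeriv_q t (hxy.le.trans ht)).mono (Ici_subset_Ici.2 hxy.le))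
    (hxy.hasDerivWithinAt_normalPos h) (hxy.hasDerivWithinAt_normalVel h)

end NormalForm

end

theorem IsPowerLipschitz.const_mul {f : ℝ → ℝ} {t₁ β : ℝ} (hf : IsPowerLipschitz t₁ β f) (A : ℝ) :
    IsPowerLipschitz t₁ β fun t => A * f t := by
  obtain ⟨C, hC, hf⟩ := hf
  refine ⟨(|A| + 1) * C, by positivity, fun s t hs ht => ?_⟩
  rw [Real.dist_eq, ← mul_sub, abs_mul, mul_assoc]
  exact mul_le_mul (by linarith) (hf s t hs ht) (abs_nonneg _) (by positivity)

/-! ### Modulated oscillations -/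

/-- The solution `A p sin (q + θ)` of the equation with amplitude `A` and phase shift `θ`. -/
def solPos (p q : ℝ → ℝ) (A θ t : ℝ) : ℝ := A * p t * Real.sin (q t + θ)

/-- The derivative of `solPos p q A θ`, the second coordinate of its phase curve. -/
def solVel (t₀ : ℝ) (p q : ℝ → ℝ) (A θ t : ℝ) : ℝ :=
  A * D t₀ 1 p t * Real.sin (q t + θ) + A * p t * D t₀ 1 q t * Real.cos (q t + θ)

theorem isBigO_sin_one (l : Filter ℝ) (ψ : ℝ → ℝ) :
    (fun t => Real.sin (ψ t)) =O[l] fun _ => (1 : ℝ) :=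
  isBigO_of_le _ fun t => by simpa using Real.abs_sin_le_one (ψ t)

theorem isBigO_cos_one (l : Filter ℝ) (ψ : ℝ → ℝ) :
    (fun t => Real.cos (ψ t)) =O[l] fun _ => (1 : ℝ) :=
  isBigO_of_le _ fun t => by simpa using Real.abs_cos_le_one (ψ t)

/-- The phase `q + θ` reduced modulo `2π` to the interval `[0, 2π)`. -/
def reducedPhase (q : ℝ → ℝ) (θ t : ℝ) : ℝ := toIcoMod Real.two_pi_pos 0 (q t + θ)

theorem reducedPhase_mem_Icc (q : ℝ → ℝ) (θ t : ℝ) :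
    reducedPhase q θ t ∈ Icc 0 (2 * Real.pi) := by
  simpa [reducedPhase] using Ico_subset_Icc_self (toIcoMod_mem_Ico Real.two_pi_pos 0 (q t + θ))

theorem sin_reducedPhase (q : ℝ → ℝ) (θ t : ℝ) :
    Real.sin (reducedPhase q θ t) = Real.sin (q t + θ) :=
  Real.sin_periodic.sub_zsmul_eq _

theorem cos_reducedPhase (q : ℝ → ℝ) (θ t : ℝ) :
    Real.cos (reducedPhase q θ t) = Real.cos (q t + θ) :=
  Real.cos_periodic.sub_zsmul_eq _

section

variable {t₀ α K t₁ m : ℝ} {p q x y : ℝ → ℝ}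

theorem IsPlanarSolution.exists_eqOn_sol (hxy : IsPlanarSolution t₀ p q t₁ x y)
    (h : AmplitudePhase t₀ α K p q) : ∃ A θ : ℝ, 0 ≤ A ∧
      EqOn x (solPos p q A θ) (Ici t₁) ∧ EqOn y (solVel t₀ p q A θ) (Ici t₁) := by
  obtain ⟨A, θ, hA, hnormal⟩ := hxy.exists_normalForm h
  have hx : EqOn x (solPos p q A θ) (Ici t₁) := fun t ht => by
    have hpos := (hnormal t ht).1
    rw [normalPos, div_eq_iff (h.p_pos t (hxy.le.trans ht)).ne'] at hpos
    rw [hpos, solPos]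
    ring
  refine ⟨A, θ, hA, hx, fun t ht => ?_⟩
  have hp := (h.p_pos t (hxy.le.trans ht)).ne'
  have hq := (h.q'_pos t (hxy.le.trans ht)).ne'
  have hvel := (hnormal t ht).2
  rw [normalVel, div_eq_iff (by positivity), hx ht, solPos] at hvel
  refine mul_right_cancel₀ hp ?_
  rw [solVel]
  linear_combination hvel

theorem IsPlanarSolution.exists_pos_eqOn_sol (hxy : IsPlanarSolution t₀ p q t₁ x y)
    (h : AmplitudePhase t₀ α K p q) (hne : ∃ t, t₁ ≤ t ∧ (x t ≠ 0 ∨ y t ≠ 0)) :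
    ∃ A θ : ℝ, 0 < A ∧
      EqOn x (solPos p q A θ) (Ici t₁) ∧ EqOn y (solVel t₀ p q A θ) (Ici t₁) := by
  obtain ⟨A, θ, hA, hx, hy⟩ := hxy.exists_eqOn_sol h
  refine ⟨A, θ, hA.lt_of_ne' ?_, hx, hy⟩
  rintro rfl
  obtain ⟨t, ht, hxt | hyt⟩ := hne
  · exact hxt (by simp [hx ht, solPos])
  · exact hyt (by simp [hy ht, solVel])

namespace AmplitudePhase

theorem isBigO_p_mul_q' (h : AmplitudePhase t₀ α K p q) :
    (fun t => p t * D t₀ 1 q t) =O[𝓟 (Ici t₀)] fun t => t ^ (-α) := by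
  simpa using h.isBigO_p.mul h.isBigO_q'

theorem isBigO_p'_rpow_neg (h : AmplitudePhase t₀ α K p q) :
    D t₀ 1 p =O[𝓟 (Ici t₀)] fun t => t ^ (-α) :=
  h.isBigO_p'.trans (isBigO_rpow_rpow_of_le h.t₀_pos (by linarith))

theorem isPowerLipschitz_p (h : AmplitudePhase t₀ α K p q) (hm : 0 < m) (hmα : m ≤ α) :
    IsPowerLipschitz t₀ (-m) p :=
  isPowerLipschitz_of_hasDerivWithinAt h.t₀_pos (neg_ne_zero.2 hm.ne') h.hasDeriv_p
    (h.isBigO_p'.trans (isBigO_rpow_rpow_of_le h.t₀_pos (by linarith)))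

theorem isPowerLipschitz_p' (h : AmplitudePhase t₀ α K p q) (hm : 0 < m) (hmα : m ≤ α) :
    IsPowerLipschitz t₀ (-m) (D t₀ 1 p) :=
  isPowerLipschitz_of_hasDerivWithinAt h.t₀_pos (neg_ne_zero.2 hm.ne') h.hasDeriv_p'
    (h.isBigO_p''.trans (isBigO_rpow_rpow_of_le h.t₀_pos (by linarith)))

theorem isPowerLipschitz_p_mul_q' (h : AmplitudePhase t₀ α K p q) (hm : 0 < m) (hmα : m ≤ α) :
    IsPowerLipschitz t₀ (-m) fun t => p t * D t₀ 1 q t := by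
  refine isPowerLipschitz_of_hasDerivWithinAt h.t₀_pos (neg_ne_zero.2 hm.ne')
    (fun t ht => (h.hasDeriv_p t ht).mul (h.hasDeriv_q' t ht)) (IsBigO.add ?_ ?_)
  · simpa using (h.isBigO_p'.trans (isBigO_rpow_rpow_of_le h.t₀_pos
      (show -α - 1 ≤ -m - 1 by linarith))).mul h.isBigO_q'
  · exact (isBigO_mul_rpow h.eventually_pos h.isBigO_p h.isBigO_q'' rfl).trans
      (isBigO_rpow_rpow_of_le h.t₀_pos (by linarith))

theorem isPowerLipschitzModAngle_solPos (h : AmplitudePhase t₀ α K p q) (hm : 0 < m)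
    (hmα : m ≤ α) (A θ : ℝ) :
    IsPowerLipschitzModAngle t₀ α m (reducedPhase q θ) (solPos p q A θ) := by
  have hmul := isPowerLipschitzModAngle_mul (ang := reducedPhase q θ)
    ((h.isPowerLipschitz_p hm hmα).const_mul A) (h.isBigO_p.const_mul_left A) h.t₀_pos
    h.α_pos.le Real.lipschitzWith_sin Real.abs_sin_le_one
  simp only [sin_reducedPhase] at hmul
  exact hmul

theorem isPowerLipschitzModAngle_solVel (h : AmplitudePhase t₀ α K p q) (hm : 0 < m)
    (hmα : m ≤ α) (A θ : ℝ) :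
    IsPowerLipschitzModAngle t₀ α m (reducedPhase q θ) (solVel t₀ p q A θ) := by
  have hsin := isPowerLipschitzModAngle_mul (ang := reducedPhase q θ)
    ((h.isPowerLipschitz_p' hm hmα).const_mul A) (h.isBigO_p'_rpow_neg.const_mul_left A)
    h.t₀_pos h.α_pos.le Real.lipschitzWith_sin Real.abs_sin_le_one
  have hcos := isPowerLipschitzModAngle_mul (ang := reducedPhase q θ)
    ((h.isPowerLipschitz_p_mul_q' hm hmα).const_mul A) (h.isBigO_p_mul_q'.const_mul_left A)
    h.t₀_pos h.α_pos.le Real.lipschitzWith_cos Real.abs_cos_le_one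
  simp only [sin_reducedPhase, cos_reducedPhase, ← mul_assoc] at hsin hcos
  exact hsin.add hcos

theorem isBigO_solPos (h : AmplitudePhase t₀ α K p q) (A θ : ℝ) :
    solPos p q A θ =O[𝓟 (Ici t₀)] fun t => t ^ (-α) := by
  have hsin := (h.isBigO_p.const_mul_left A).mul (isBigO_sin_one _ fun t => q t + θ)
  simp only [mul_one] at hsin
  exact hsin

theorem isBigO_solVel (h : AmplitudePhase t₀ α K p q) (A θ : ℝ) :
    solVel t₀ p q A θ =O[𝓟 (Ici t₀)] fun t => t ^ (-α) := by
  have hsin := (h.isBigO_p'_rpow_neg.const_mul_left A).mul (isBigO_sin_one _ fun t => q t + θ)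
  have hcos := (h.isBigO_p_mul_q'.const_mul_left A).mul (isBigO_cos_one _ fun t => q t + θ)
  simp only [mul_one, ← mul_assoc] at hsin hcos
  exact hsin.add hcos

end AmplitudePhase

namespace IsPlanarSolution

variable {β : ℝ}

theorem isBigO_x (hxy : IsPlanarSolution t₀ p q t₁ x y) (h : AmplitudePhase t₀ α K p q) :
    x =O[𝓟 (Ici t₁)] fun t => t ^ (-α) := by
  obtain ⟨A, θ, -, hx, -⟩ := hxy.exists_eqOn_sol h
  exact ((h.isBigO_solPos A θ).mono (principal_mono.2 (Ici_subset_Ici.2 hxy.le))).congr'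
    (eventuallyEq_principal.2 hx.symm) EventuallyEq.rfl

theorem isBigO_y (hxy : IsPlanarSolution t₀ p q t₁ x y) (h : AmplitudePhase t₀ α K p q) :
    y =O[𝓟 (Ici t₁)] fun t => t ^ (-α) := by
  obtain ⟨A, θ, -, -, hy⟩ := hxy.exists_eqOn_sol h
  exact ((h.isBigO_solVel A θ).mono (principal_mono.2 (Ici_subset_Ici.2 hxy.le))).congr'
    (eventuallyEq_principal.2 hy.symm) EventuallyEq.rfl

theorem isPowerLipschitz_x (hxy : IsPlanarSolution t₀ p q t₁ x y) (h : AmplitudePhase t₀ α K p q)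
    (hβ : β ≠ 0) (hβα : 1 - α ≤ β) : IsPowerLipschitz t₁ β x :=
  have ht₁ := h.t₀_pos.trans_le hxy.le
  isPowerLipschitz_of_hasDerivWithinAt ht₁ hβ hxy.x_deriv
    ((hxy.isBigO_y h).trans (isBigO_rpow_rpow_of_le ht₁ (by linarith)))

theorem isPowerLipschitz_y (hxy : IsPlanarSolution t₀ p q t₁ x y) (h : AmplitudePhase t₀ α K p q)
    (hβ : β ≠ 0) (hβα : 1 - α ≤ β) : IsPowerLipschitz t₁ β y := by
  have ht₁ := h.t₀_pos.trans_le hxy.le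
  have hIci : 𝓟 (Ici t₁) ≤ 𝓟 (Ici t₀) := principal_mono.2 (Ici_subset_Ici.2 hxy.le)
  have hb := (h.isBigO_restoringCoeff_one.mono hIci).neg_left.mul (hxy.isBigO_x h)
  have ha := (h.isBigO_dampingCoeff_one.mono hIci).mul (hxy.isBigO_y h)
  simp only [one_mul] at hb ha
  exact isPowerLipschitz_of_hasDerivWithinAt ht₁ hβ hxy.y_deriv
    ((hb.add ha).trans (isBigO_rpow_rpow_of_le ht₁ (by linarith)))

end IsPlanarSolution

end

/-! ### Density of the spirals in planar regions -/

theorem isPowerLipschitz_rpow (t₁ β : ℝ) : IsPowerLipschitz t₁ β fun t : ℝ => t ^ β :=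
  ⟨1, one_pos, fun _ _ _ _ => (one_mul _).ge⟩

theorem IsPowerLipschitz.exists_dist_le_of_le_add {X : Type*} [PseudoMetricSpace X] {f : ℝ → X}
    {t₁ m : ℝ} (hf : IsPowerLipschitz t₁ (-m) f) (ht₁ : 0 < t₁) (hm : 0 < m) {δ : ℝ} (hδ : 0 < δ) :
    ∃ C, 0 < C ∧ ∀ τ t, t₁ ≤ τ → t ∈ Icc τ (τ + δ) → dist (f t) (f τ) ≤ C * τ ^ (-m - 1) := by
  obtain ⟨C, hC, hf⟩ := hf
  refine ⟨C * (m * δ), by positivity, fun τ t hτ ht => ?_⟩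
  have hτ0 : 0 < τ := ht₁.trans_le hτ
  have hincr : |t ^ (-m) - τ ^ (-m)| ≤ m * τ ^ (-m - 1) * t - m * τ ^ (-m - 1) * τ := by
    refine norm_sub_le_of_norm_deriv_le (a := τ) (f := fun t : ℝ => t ^ (-m))
      (B := fun t => m * τ ^ (-m - 1) * t)
      (fun u hu => (Real.hasDerivAt_rpow_const (Or.inl (hτ0.trans_le hu).ne')).hasDerivWithinAt)
      (fun u _ => by simpa using ((hasDerivAt_id u).const_mul (m * τ ^ (-m - 1))).hasDerivWithinAt)
      (fun u hu => ?_) le_rfl ht.1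
    have hu0 : 0 < u := hτ0.trans_le hu
    rw [norm_mul, norm_neg, Real.norm_of_nonneg hm.le, Real.norm_of_nonneg (by positivity)]
    exact mul_le_mul_of_nonneg_left (Real.rpow_le_rpow_of_nonpos hτ0 hu (by linarith)) hm.le
  calc dist (f t) (f τ) ≤ C * |t ^ (-m) - τ ^ (-m)| := hf t τ (hτ.trans ht.1) hτ
    _ ≤ C * (m * τ ^ (-m - 1) * t - m * τ ^ (-m - 1) * τ) := by gcongr
    _ = C * (m * τ ^ (-m - 1) * (t - τ)) := by ring
    _ ≤ C * (m * τ ^ (-m - 1) * δ) := by gcongr; linarith [ht.2]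
    _ = C * (m * δ) * τ ^ (-m - 1) := by ring

namespace AmplitudePhase

variable {t₀ α K t₁ γ A Z : ℝ} {p q : ℝ → ℝ}

theorem exists_mul_rpow_le_p (h : AmplitudePhase t₀ α K p q) :
    ∃ c, 0 < c ∧ ∀ t, t₀ ≤ t → c * t ^ (-α) ≤ p t := by
  obtain ⟨C, hC, hp⟩ := h.isBigO_rpow.exists_pos
  rw [isBigOWith_principal] at hp
  refine ⟨C⁻¹, by positivity, fun t ht => ?_⟩
  have ht' := hp t ht
  rw [Real.norm_of_nonneg (Real.rpow_nonneg (h.t₀_pos.trans_le ht).le _),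
    Real.norm_of_nonneg (h.p_pos t ht).le] at ht'
  exact inv_mul_le_of_le_mul₀ hC.le (h.p_pos t ht).le ht'

theorem exists_p_eq (h : AmplitudePhase t₀ α K p q) {T r : ℝ} (hT : t₀ ≤ T) (hr : 0 < r)
    (hrT : r ≤ p T) : ∃ τ, T ≤ τ ∧ p τ = r := by
  have hlim : Tendsto p atTop (𝓝 0) := tendsto_zero_of_isBigO h.isBigO_p h.α_pos
  obtain ⟨T', hT'r, hT'⟩ := ((hlim.eventually (gt_mem_nhds hr)).and (eventually_ge_atTop T)).exists
  have hcont : ContinuousOn p (Ici T) := fun t ht =>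
    (h.hasDeriv_p t (hT.trans ht)).continuousWithinAt.mono (Ici_subset_Ici.2 hT)
  exact isPreconnected_Ici.intermediate_value hT' self_mem_Ici hcont ⟨hT'r.le, hrT⟩

theorem exists_pos_le_q' (h : AmplitudePhase t₀ α K p q) :
    ∃ c, 0 < c ∧ ∀ t, t₀ ≤ t → c ≤ D t₀ 1 q t := by
  obtain ⟨C, hC, hq⟩ := h.isBigO_one_q'.exists_pos
  rw [isBigOWith_principal] at hq
  refine ⟨C⁻¹, by positivity, fun t ht => ?_⟩
  have ht' := hq t ht
  rw [norm_one, Real.norm_of_nonneg (h.q'_pos t ht).le] at ht'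
  exact (inv_le_iff_one_le_mul₀' hC).2 ht'

theorem exists_phase_eq (h : AmplitudePhase t₀ α K p q) :
    ∃ δ, 0 < δ ∧ ∀ τ θ β, t₀ ≤ τ → ∃ t ∈ Icc τ (τ + δ),
      Real.sin (q t + θ) = Real.sin β ∧ Real.cos (q t + θ) = Real.cos β := by
  obtain ⟨c, hc, hq'⟩ := h.exists_pos_le_q'
  refine ⟨2 * Real.pi / c, div_pos Real.two_pi_pos hc, fun τ θ β hτ => ?_⟩
  have hτδ : τ ≤ τ + 2 * Real.pi / c := le_add_of_nonneg_right (by positivity)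
  have hgrowth : q τ + 2 * Real.pi ≤ q (τ + 2 * Real.pi / c) := by
    have hle := norm_sub_le_of_norm_deriv_le (f := fun t => c * t)
      (fun t _ => ((hasDerivAt_id t).const_mul c).hasDerivWithinAt) h.hasDeriv_q
      (fun t ht => by simpa [abs_of_pos hc] using hq' t ht) hτ hτδ
    have habs := (le_abs_self _).trans hle
    rw [← mul_sub, add_sub_cancel_left, mul_div_cancel₀ _ hc.ne'] at habs
    linarith
  have hβ := toIcoMod_mem_Ico Real.two_pi_pos (q τ + θ) β
  obtain ⟨t, ht, hqt⟩ := intermediate_value_Icc hτδ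
    (fun t ht => (h.hasDeriv_q t (hτ.trans ht.1)).continuousWithinAt.mono
      fun s hs => hτ.trans hs.1)
    (show toIcoMod Real.two_pi_pos (q τ + θ) β - θ ∈ Icc (q τ) (q (τ + 2 * Real.pi / c)) from
      ⟨by linarith [hβ.1], by linarith [hβ.2]⟩)
  refine ⟨t, ht, ?_, ?_⟩ <;> rw [hqt, sub_add_cancel]
  exacts [Real.sin_periodic.sub_zsmul_eq _, Real.cos_periodic.sub_zsmul_eq _]

theorem isBigO_solVel_sub (h : AmplitudePhase t₀ α K p q) (A θ : ℝ) :
    (fun t => solVel t₀ p q A θ t - K * (A * p t) * Real.cos (q t + θ)) =O[𝓟 (Ici t₀)]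
      fun t => t ^ (-α - 1) := by
  have hsin := (h.isBigO_p'.const_mul_left A).mul (isBigO_sin_one _ fun t => q t + θ)
  have hcos := ((isBigO_mul_rpow h.eventually_pos h.isBigO_p h.isBigO_q'_sub rfl).const_mul_left
    A).mul (isBigO_cos_one _ fun t => q t + θ)
  simp only [mul_one] at hsin hcos
  refine (hsin.add hcos).congr_left fun t => ?_
  rw [solVel]
  ring

theorem exists_sol_near (h : AmplitudePhase t₀ α K p q) (A θ : ℝ) :
    ∃ δ M, 0 < δ ∧ 0 < M ∧ ∀ τ β, t₀ ≤ τ → ∃ t ∈ Icc τ (τ + δ),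
      |solPos p q A θ t - A * p τ * Real.sin β| ≤ M * τ ^ (-α - 1) ∧
      |solVel t₀ p q A θ t - K * (A * p τ) * Real.cos β| ≤ M * τ ^ (-α - 1) := by
  obtain ⟨δ, hδ, hphase⟩ := h.exists_phase_eq
  obtain ⟨C, hC, hp⟩ := ((h.isPowerLipschitz_p h.α_pos le_rfl).const_mul A).exists_dist_le_of_le_add
    h.t₀_pos h.α_pos hδ
  obtain ⟨C', hC', hvel⟩ := (h.isBigO_solVel_sub A θ).exists_pos
  rw [isBigOWith_principal] at hvel
  have hK := h.K_pos
  refine ⟨δ, C + K * C + C', hδ, by positivity, fun τ β hτ => ?_⟩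
  obtain ⟨t, ht, hsin, hcos⟩ := hphase τ θ β hτ
  have hτ0 : 0 < τ := h.t₀_pos.trans_le hτ
  have ht0 : 0 < t := hτ0.trans_le ht.1
  have hamp : |A * p t - A * p τ| ≤ C * τ ^ (-α - 1) := hp τ t hτ ht
  have hrem : |solVel t₀ p q A θ t - K * (A * p t) * Real.cos β| ≤ C' * τ ^ (-α - 1) := by
    have hvel_t := hvel t (hτ.trans ht.1)
    rw [hcos, Real.norm_eq_abs, Real.norm_of_nonneg (by positivity)] at hvel_t
    refine hvel_t.trans ?_
    gcongr C' * ?_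
    exact Real.rpow_le_rpow_of_nonpos hτ0 ht.1 (by linarith [h.α_pos])
  refine ⟨t, ht, ?_, ?_⟩
  · calc |solPos p q A θ t - A * p τ * Real.sin β| = |A * p t - A * p τ| * |Real.sin β| := by
          rw [solPos, hsin, ← sub_mul, abs_mul]
      _ ≤ C * τ ^ (-α - 1) * 1 := by gcongr; exact Real.abs_sin_le_one β
      _ ≤ (C + K * C + C') * τ ^ (-α - 1) := by
          rw [mul_one]
          gcongr
          linarith [mul_pos hK hC]
  · calc |solVel t₀ p q A θ t - K * (A * p τ) * Real.cos β|
        = |solVel t₀ p q A θ t - K * (A * p t) * Real.cos β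
            + K * (A * p t - A * p τ) * Real.cos β| := by ring_nf
      _ ≤ C' * τ ^ (-α - 1) + K * (C * τ ^ (-α - 1)) * 1 := by
          refine (abs_add_le _ _).trans (add_le_add hrem ?_)
          rw [abs_mul, abs_mul, abs_of_pos hK]
          gcongr
          exact Real.abs_cos_le_one β
      _ ≤ (C + K * C + C') * τ ^ (-α - 1) := by
          have : 0 < C * τ ^ (-α - 1) := by positivity
          linarith

theorem hasDenseRegions_solPos_solVel (h : AmplitudePhase t₀ α K p q) (ht₁ : t₀ ≤ t₁)
    (hA : 0 < A) (θ : ℝ) :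
    HasDenseRegions α α ((fun t => (solPos p q A θ t, solVel t₀ p q A θ t)) '' Ici t₁) := by
  obtain ⟨c, hc, hp⟩ := h.exists_mul_rpow_le_p
  obtain ⟨δ, M, -, hM, hnear⟩ := h.exists_sol_near A θ
  have hK := h.K_pos
  set k := A * c / 2 with hk
  refine ⟨k * (K * k), M + 1, by positivity, by positivity, ?_⟩
  filter_upwards [eventually_ge_atTop t₁] with T hT
  have hT0 : 0 < T := h.t₀_pos.trans_le (ht₁.trans hT)
  refine ⟨Ioc 0 (k * T ^ (-α)) ×ˢ Ioc 0 (K * k * T ^ (-α)), ?_, ?_⟩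
  · rw [Measure.volume_eq_prod, Measure.prod_prod, Real.volume_Ioc, Real.volume_Ioc, sub_zero,
      sub_zero, ← ENNReal.ofReal_mul (by positivity), sub_eq_add_neg, Real.rpow_add hT0]
    exact ENNReal.ofReal_le_ofReal (by ring_nf; rfl)
  rintro ⟨v, w⟩ ⟨hv, hw⟩
  set ζ : ℂ := ⟨w / K, v⟩
  have hw0 : 0 < w / K := div_pos hw.1 hK
  have hζ_pos : 0 < ‖ζ‖ := norm_pos_iff.2 fun h0 => hv.1.ne' (congrArg Complex.im h0)
  have hζ_le : ‖ζ‖ / A ≤ p T := by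
    have hw' : w / K ≤ k * T ^ (-α) := (div_le_iff₀' hK).2 (hw.2.trans_eq (mul_assoc _ _ _))
    refine ((div_le_iff₀' hA).2 ?_).trans (hp T (ht₁.trans hT))
    calc ‖ζ‖ ≤ |w / K| + |v| := Complex.norm_le_abs_re_add_abs_im ζ
      _ ≤ k * T ^ (-α) + k * T ^ (-α) := by
          rw [abs_of_pos hw0, abs_of_pos hv.1]
          exact add_le_add hw' hv.2
      _ = A * (c * T ^ (-α)) := by rw [hk]; ring
  obtain ⟨τ, hτ, hpτ⟩ := h.exists_p_eq (ht₁.trans hT) (by positivity) hζ_le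
  have hρ : A * p τ = ‖ζ‖ := by rw [hpτ]; field_simp
  obtain ⟨t, ht, hpos, hvel⟩ := hnear τ ζ.arg (ht₁.trans (hT.trans hτ))
  rw [hρ, Complex.norm_mul_sin_arg] at hpos
  rw [hρ, mul_assoc, Complex.norm_mul_cos_arg, mul_div_cancel₀ _ hK.ne'] at hvel
  have hMT : M * τ ^ (-α - 1) < (M + 1) * T ^ (-α - 1) :=
    mul_lt_mul (lt_add_one M) (Real.rpow_le_rpow_of_nonpos hT0 hτ (by linarith [h.α_pos]))
      (Real.rpow_pos_of_pos (hT0.trans_le hτ) _) (by positivity)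
  rw [Metric.mem_thickening_iff]
  refine ⟨_, mem_image_of_mem _ (hT.trans (hτ.trans ht.1)), ?_⟩
  rw [dist_comm, Prod.dist_eq]
  exact max_lt (hpos.trans_lt hMT) (hvel.trans_lt hMT)

theorem exists_mul_rpow_le_p_of_mem_Icc (h : AmplitudePhase t₀ α K p q) :
    ∃ c, 0 < c ∧ ∀ T τ, t₀ ≤ T → τ ∈ Icc T (2 * T) → c * T ^ (-α) ≤ p τ := by
  obtain ⟨c, hc, hp⟩ := h.exists_mul_rpow_le_p
  refine ⟨c * 2 ^ (-α), by positivity, fun T τ hT hτ => ?_⟩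
  have hT0 : 0 < T := h.t₀_pos.trans_le hT
  calc c * 2 ^ (-α) * T ^ (-α) = c * (2 * T) ^ (-α) := by
        rw [Real.mul_rpow zero_le_two hT0.le, mul_assoc]
    _ ≤ c * τ ^ (-α) := by
        gcongr c * ?_
        exact Real.rpow_le_rpow_of_nonpos (hT0.trans_le hτ.1) hτ.2 (neg_nonpos.2 h.α_pos.le)
    _ ≤ p τ := hp τ (hT.trans hτ.1)

theorem hasDenseRegions_solPos_rpow (h : AmplitudePhase t₀ α K p q) (ht₁ : t₀ ≤ t₁)
    (hA : 0 < A) (θ : ℝ) (hZ : 0 < Z) (hγ : 0 < γ) (hγα : γ ≤ α) :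
    HasDenseRegions α γ ((fun t => (solPos p q A θ t, Z * t ^ (-γ))) '' Ici t₁) := by
  obtain ⟨c, hc, hp⟩ := h.exists_mul_rpow_le_p_of_mem_Icc
  obtain ⟨δ, M, hδ, hM, hnear⟩ := h.exists_sol_near A θ
  obtain ⟨C, hC, hz⟩ := ((isPowerLipschitz_rpow t₀ (-γ)).const_mul Z).exists_dist_le_of_le_add
    h.t₀_pos hγ hδ
  have h2γ : (2 : ℝ) ^ (-γ) < 1 := Real.rpow_lt_one_of_one_lt_of_neg one_lt_two (neg_neg_of_pos hγ)
  refine ⟨A * c * (Z * (1 - 2 ^ (-γ))), M + C, mul_pos (by positivity) (mul_pos hZ (sub_pos.2 h2γ)),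
    by positivity, ?_⟩
  filter_upwards [eventually_ge_atTop t₁, eventually_ge_atTop 1] with T hT hT1
  have hT0 : 0 < T := one_pos.trans_le hT1
  refine ⟨Icc 0 (A * c * T ^ (-α)) ×ˢ Icc (Z * (2 * T) ^ (-γ)) (Z * T ^ (-γ)), ?_, ?_⟩
  · rw [Measure.volume_eq_prod, Measure.prod_prod, Real.volume_Icc, Real.volume_Icc, sub_zero,
      ← ENNReal.ofReal_mul (by positivity), sub_eq_add_neg (-α), Real.rpow_add hT0,
      Real.mul_rpow zero_le_two hT0.le]
    exact ENNReal.ofReal_le_ofReal (by ring_nf; rfl)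
  rintro ⟨v, w⟩ ⟨hv, hw⟩
  obtain ⟨τ, hτ, rfl⟩ := intermediate_value_Icc' (by linarith : T ≤ 2 * T)
    (((continuousOn_rpow_Ici hT0 (-γ)).mono Icc_subset_Ici_self).const_smul Z) hw
  have hTτ : t₁ ≤ τ := hT.trans hτ.1
  have hAp : 0 < A * p τ := mul_pos hA (h.p_pos τ (ht₁.trans hTτ))
  have hvp : v / (A * p τ) ≤ 1 := by
    rw [div_le_one hAp]
    calc v ≤ A * (c * T ^ (-α)) := hv.2.trans_eq (mul_assoc _ _ _)
      _ ≤ A * p τ := by gcongr; exact hp T τ (ht₁.trans hT) hτ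
  obtain ⟨t, ht, hpos, -⟩ := hnear τ (Real.arcsin (v / (A * p τ))) (ht₁.trans hTτ)
  rw [Real.sin_arcsin (neg_one_lt_zero.le.trans (div_nonneg hv.1 hAp.le)) hvp,
    mul_div_cancel₀ _ hAp.ne'] at hpos
  have hbound : ∀ r ≤ -γ - 1, τ ^ r ≤ T ^ (-γ - 1) := fun r hr =>
    (Real.rpow_le_rpow_of_nonpos hT0 hτ.1 (by linarith)).trans
      (Real.rpow_le_rpow_of_exponent_le hT1 hr)
  rw [Metric.mem_thickening_iff]
  refine ⟨_, mem_image_of_mem _ (hTτ.trans ht.1), ?_⟩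
  rw [dist_comm, Prod.dist_eq]
  refine max_lt ?_ ?_
  · calc |solPos p q A θ t - v| ≤ M * τ ^ (-α - 1) := hpos
      _ ≤ M * T ^ (-γ - 1) := mul_le_mul_of_nonneg_left (hbound _ (by linarith)) hM.le
      _ < (M + C) * T ^ (-γ - 1) := by gcongr; linarith
  · calc dist (Z * t ^ (-γ)) (Z * τ ^ (-γ)) ≤ C * τ ^ (-γ - 1) := hz τ t (ht₁.trans hTτ) ht
      _ ≤ C * T ^ (-γ - 1) := mul_le_mul_of_nonneg_left (hbound _ le_rfl) hC.le
      _ < (M + C) * T ^ (-γ - 1) := by gcongr; linarith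

end AmplitudePhase

/-! ### Polar angle of a planar curve -/

theorem exists_antideriv {E : Type*} [NormedAddCommGroup E] [NormedSpace ℝ E] [CompleteSpace E]
    {a : ℝ} {g : ℝ → E} (hg : ContinuousOn g (Ici a)) (c : E) :
    ∃ F : ℝ → E, F a = c ∧ ∀ t, a ≤ t → HasDerivWithinAt F (g t) (Ici a) t := by
  have hcont : Continuous fun s => g (max a s) :=
    hg.comp_continuous (continuous_const.max continuous_id) fun s => le_max_left a s
  refine ⟨fun t => c + ∫ s in a..t, g (max a s), by simp, fun t ht => ?_⟩
  have hderiv := ((hcont.integral_hasStrictDerivAt a t).hasDerivAt.const_add c).hasDerivWithinAt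
    (s := Ici a)
  rwa [max_eq_right ht] at hderiv

theorem exists_log_of_hasDerivWithinAt {a : ℝ} {z z' : ℝ → ℂ}
    (hz : ∀ t, a ≤ t → HasDerivWithinAt z (z' t) (Ici a) t) (hz' : ContinuousOn z' (Ici a))
    (hne : ∀ t, a ≤ t → z t ≠ 0) :
    ∃ F : ℝ → ℂ, F a = Complex.log (z a) ∧
      (∀ t, a ≤ t → HasDerivWithinAt F (z' t / z t) (Ici a) t) ∧
      ∀ t, a ≤ t → z t = Complex.exp (F t) := by
  have hz_cont : ContinuousOn z (Ici a) := fun t ht => (hz t ht).continuousWithinAt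
  obtain ⟨F, hFa, hF⟩ := exists_antideriv (hz'.div hz_cont hne) (Complex.log (z a))
  refine ⟨F, hFa, hF, fun t ht => ?_⟩
  have hderiv : ∀ t, a ≤ t →
      HasDerivWithinAt (fun t => z t * Complex.exp (-F t)) 0 (Ici a) t := by
    intro t ht
    convert! (hz t ht).mul (hF t ht).neg.cexp using 1
    have hzt := hne t ht
    simp only [Pi.neg_apply, Pi.div_apply]
    field_simp
    ring
  have hconst : z t * Complex.exp (-F t) = z a * Complex.exp (-F a) := by
    rw [← sub_eq_zero, ← norm_le_zero_iff]
    simpa using norm_sub_le_of_norm_deriv_le (B := 0) (B' := 0) hderiv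
      (fun t _ => hasDerivWithinAt_const t _ 0) (by simp) le_rfl ht
  rwa [hFa, Complex.exp_neg, Complex.exp_neg, Complex.exp_log (hne a le_rfl),
    mul_inv_cancel₀ (hne a le_rfl), mul_inv_eq_one₀ (Complex.exp_ne_zero _)] at hconst

theorem exists_clockwise_angle {a : ℝ} {x y x' y' : ℝ → ℝ}
    (hx : ∀ t, a ≤ t → HasDerivWithinAt x (x' t) (Ici a) t)
    (hy : ∀ t, a ≤ t → HasDerivWithinAt y (y' t) (Ici a) t)
    (hx' : ContinuousOn x' (Ici a)) (hy' : ContinuousOn y' (Ici a))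
    (hne : ∀ t, a ≤ t → x t ≠ 0 ∨ y t ≠ 0) :
    ∃ R φ : ℝ → ℝ, 0 < φ a ∧ (∀ t, 0 < R t) ∧
      (∀ t, a ≤ t → x t = R t * Real.cos (φ t) ∧ y t = -(R t * Real.sin (φ t))) ∧
      ∀ t, a ≤ t → HasDerivWithinAt φ ((y t * x' t - x t * y' t) / (x t ^ 2 + y t ^ 2))
        (Ici a) t := by
  obtain ⟨F, hFa, hF, hexp⟩ := exists_log_of_hasDerivWithinAt
    (z := fun t => ⟨x t, y t⟩) (z' := fun t => ⟨x' t, y' t⟩)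
    (fun t ht => by
      simp only [Complex.mk_eq_add_mul_I]
      exact (hx t ht).ofReal_comp.add ((hy t ht).ofReal_comp.mul_const Complex.I))
    (by
      simp only [Complex.mk_eq_add_mul_I]
      fun_prop)
    (fun t ht => by simpa [Complex.ext_iff, imp_iff_not_or] using hne t ht)
  refine ⟨fun t => Real.exp (F t).re, fun t => 2 * Real.pi - (F t).im, ?_,
    fun t => Real.exp_pos _, fun t ht => ?_, fun t ht => ?_⟩
  · simp only [hFa, Complex.log_im]
    linarith [Complex.arg_le_pi ⟨x a, y a⟩, Real.pi_pos]
  · have hre := congrArg Complex.re (hexp t ht)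
    have him := congrArg Complex.im (hexp t ht)
    rw [Complex.exp_re] at hre
    rw [Complex.exp_im] at him
    simpa using ⟨hre, him⟩
  · convert! (Complex.imCLM.hasFDerivAt.comp_hasDerivWithinAt t (hF t ht)).const_sub
      (2 * Real.pi) using 1
    simp [Complex.div_im, Complex.normSq_mk]
    ring

theorem exists_invOn_Ici {a : ℝ} {φ : ℝ → ℝ} (hφ : ContinuousOn φ (Ici a))
    (hmono : StrictMonoOn φ (Ici a)) (htop : Tendsto φ atTop atTop) :
    ∃ τ : ℝ → ℝ, InvOn τ φ (Ici a) (Ici (φ a)) ∧ MapsTo τ (Ici (φ a)) (Ici a) ∧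
      StrictMonoOn τ (Ici (φ a)) ∧ Tendsto τ atTop atTop := by
  have hsurj : SurjOn φ (Ici a) (Ici (φ a)) := by
    intro ϕ hϕ
    obtain ⟨T, hϕT, haT⟩ := ((htop.eventually_ge_atTop ϕ).and (eventually_ge_atTop a)).exists
    exact isPreconnected_Ici.intermediate_value self_mem_Ici haT hφ ⟨hϕ, hϕT⟩
  have hmaps := hsurj.mapsTo_invFunOn
  have hright := hsurj.rightInvOn_invFunOn
  have hτ_mono : StrictMonoOn (Function.invFunOn φ (Ici a)) (Ici (φ a)) := fun ϕ hϕ ψ hψ hlt =>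
    (hmono.lt_iff_lt (hmaps hϕ) (hmaps hψ)).1 (by rwa [hright hϕ, hright hψ])
  refine ⟨_, ⟨hmono.injOn.leftInvOn_invFunOn, hright⟩, hmaps, hτ_mono,
    tendsto_atTop.2 fun b => ?_⟩
  filter_upwards [eventually_ge_atTop (φ (max a b)), eventually_ge_atTop (φ a)] with ϕ hb ha
  refine (le_max_right a b).trans ((hmono.le_iff_le (le_max_left a b) (hmaps ha)).1 ?_)
  rwa [hright ha]

theorem isSpiral_of_clockwise_angle {a : ℝ} {R φ : ℝ → ℝ} (hφa : 0 < φ a)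
    (hφ : ContinuousOn φ (Ici a)) (hmono : StrictMonoOn φ (Ici a)) (htop : Tendsto φ atTop atTop)
    (hR : ∀ t, 0 < R t) (hR0 : Tendsto R atTop (𝓝 0))
    (hturn : ∀ t t', a ≤ t → t < t' → φ t' = φ t + 2 * Real.pi → R t' < R t) :
    IsSpiral ((fun t => !₂[R t * Real.cos (φ t), -(R t * Real.sin (φ t))]) '' Ici a) := by
  obtain ⟨τ, ⟨hleft, hright⟩, hmaps, hτ_mono, hτ_top⟩ := exists_invOn_Ici hφ hmono htop
  have himage : φ '' Ici a = Ici (φ a) :=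
    (InvOn.bijOn ⟨hleft, hright⟩ hmono.monotoneOn.mapsTo_Ici hmaps).image_eq
  refine ⟨φ a, R ∘ τ, hφa, fun ϕ _ => hR _, hR0.comp hτ_top, fun ϕ hϕ => ?_, Or.inr ?_⟩
  · have hmem : ∀ k : ℕ, φ a ≤ ϕ + 2 * (k : ℝ) * Real.pi := fun k =>
      le_add_of_le_of_nonneg hϕ (by positivity)
    refine strictAnti_nat_of_succ_lt fun k => hturn _ _ (hmaps (hmem k))
      (hτ_mono (hmem k) (hmem (k + 1)) ?_) ?_
    · push_cast
      linarith [Real.pi_pos]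
    · rw [hright (hmem k), hright (hmem (k + 1))]
      push_cast
      ring
  · rw [← himage, image_image]
    refine image_congr fun t ht => ?_
    simp only [Function.comp_apply, hleft ht]

section

variable {t₀ α K t₁ : ℝ} {p q x y : ℝ → ℝ}

theorem isLittleO_rpow_rpow_of_lt {a b : ℝ} (hab : a < b) :
    (fun t : ℝ => t ^ a) =o[atTop] fun t => t ^ b := by
  have hpos : ∀ᶠ t : ℝ in atTop, 0 < t := eventually_gt_atTop 0
  refine (isLittleO_iff_tendsto' ?_).2 ((tendsto_rpow_neg_atTop (sub_pos.2 hab)).congr' ?_) <;>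
    filter_upwards [hpos] with t ht
  · exact fun h => absurd h (Real.rpow_pos_of_pos ht b).ne'
  · rw [neg_sub, Real.rpow_sub ht]

/-! ### Contraction of the phase portrait -/

/-- The square of the amplitude `A` of the solution `A p sin (q + θ)` that passes through the phase
point `(x, y)` at time `t`. -/
def amplitudeSq (t₀ : ℝ) (p q : ℝ → ℝ) (x y t : ℝ) : ℝ :=
  normalPos p x t ^ 2 + normalVel t₀ p q x y t ^ 2

theorem amplitudeSq_mul (l u v t : ℝ) :
    amplitudeSq t₀ p q (l * u) (l * v) t = l ^ 2 * amplitudeSq t₀ p q u v t := by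
  simp only [amplitudeSq, normalPos, normalVel]
  ring

theorem IsPlanarSolution.amplitudeSq_eq (hxy : IsPlanarSolution t₀ p q t₁ x y)
    (h : AmplitudePhase t₀ α K p q) {s t : ℝ} (hs : t₁ ≤ s) (ht : t₁ ≤ t) :
    amplitudeSq t₀ p q (x s) (y s) s = amplitudeSq t₀ p q (x t) (y t) t := by
  obtain ⟨A, θ, -, hform⟩ := hxy.exists_normalForm h
  have hA : ∀ t, t₁ ≤ t → amplitudeSq t₀ p q (x t) (y t) t = A ^ 2 := fun t ht => by
    rw [amplitudeSq, (hform t ht).1, (hform t ht).2]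
    linear_combination A ^ 2 * Real.sin_sq_add_cos_sq (q t + θ)
  rw [hA s hs, hA t ht]

namespace AmplitudePhase

theorem amplitudeSq_pos (h : AmplitudePhase t₀ α K p q) {t : ℝ} (ht : t₀ ≤ t) {u v : ℝ}
    (huv : u ≠ 0 ∨ v ≠ 0) : 0 < amplitudeSq t₀ p q u v t := by
  have hp := (h.p_pos t ht).ne'
  have hq := (h.q'_pos t ht).ne'
  rcases eq_or_ne u 0 with rfl | hu
  · have hvel : normalVel t₀ p q 0 v t ≠ 0 := by
      simp [normalVel, hp, hq, huv.resolve_left (· rfl)]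
    exact add_pos_of_nonneg_of_pos (sq_nonneg _) (sq_pos_of_ne_zero hvel)
  · exact add_pos_of_pos_of_nonneg (sq_pos_of_ne_zero (div_ne_zero hu hp)) (sq_nonneg _)

theorem hasDerivWithinAt_normalPos (h : AmplitudePhase t₀ α K p q) (u t : ℝ) (ht : t₀ ≤ t) :
    HasDerivWithinAt (normalPos p u) (-(D t₀ 1 p t / p t) * normalPos p u t) (Ici t₀) t := by
  have hp := (h.p_pos t ht).ne'
  convert! (hasDerivWithinAt_const t (Ici t₀) u).div (h.hasDeriv_p t ht) hp using 1
  rw [normalPos]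
  field_simp
  ring

theorem hasDerivWithinAt_normalVel (h : AmplitudePhase t₀ α K p q) (u v t : ℝ) (ht : t₀ ≤ t) :
    HasDerivWithinAt (normalVel t₀ p q u v)
      (-(D t₀ 1 p t / p t + D t₀ 2 q t / D t₀ 1 q t) * normalVel t₀ p q u v t
        + ((D t₀ 1 p t / p t) ^ 2 - D t₀ 2 p t / p t) / D t₀ 1 q t * normalPos p u t)
      (Ici t₀) t := by
  have hp := (h.p_pos t ht).ne'
  have hq := (h.q'_pos t ht).ne'
  have hdp := h.hasDeriv_p t ht
  convert! ((hdp.const_mul v).sub ((h.hasDeriv_p' t ht).const_mul u)).div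
    ((hdp.pow 2).mul (h.hasDeriv_q' t ht)) (mul_ne_zero (pow_ne_zero 2 hp) hq) using 1
  simp only [normalPos, normalVel, Pi.mul_apply, Pi.sub_apply, Pi.pow_apply]
  field_simp
  ring

theorem hasDerivWithinAt_amplitudeSq (h : AmplitudePhase t₀ α K p q) (u v t : ℝ) (ht : t₀ ≤ t) :
    HasDerivWithinAt (amplitudeSq t₀ p q u v)
      (-(2 * (D t₀ 1 p t / p t)) * amplitudeSq t₀ p q u v t
        - 2 * (D t₀ 2 q t / D t₀ 1 q t) * normalVel t₀ p q u v t ^ 2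
        + 2 * (((D t₀ 1 p t / p t) ^ 2 - D t₀ 2 p t / p t) / D t₀ 1 q t)
          * (normalPos p u t * normalVel t₀ p q u v t)) (Ici t₀) t := by
  convert! ((h.hasDerivWithinAt_normalPos u t ht).pow 2).add
    ((h.hasDerivWithinAt_normalVel u v t ht).pow 2) using 1
  rw [amplitudeSq]
  ring

theorem isBigO_contractionError (h : AmplitudePhase t₀ α K p q) :
    (fun t => 2 * |D t₀ 2 q t / D t₀ 1 q t|
        + |((D t₀ 1 p t / p t) ^ 2 - D t₀ 2 p t / p t) / D t₀ 1 q t|)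
      =O[𝓟 (Ici t₀)] fun t => t ^ (-2 : ℝ) := by
  have hcross := (h.isBigO_p'_div_sq.sub h.isBigO_p''_div).mul h.isBigO_inv_q'
  simp only [mul_one, ← div_eq_mul_inv] at hcross
  exact (h.isBigO_q''_div.norm_left.const_mul_left 2).add hcross.norm_left

theorem eventually_contractionError_lt (h : AmplitudePhase t₀ α K p q) :
    ∀ᶠ t in atTop, 2 * |D t₀ 2 q t / D t₀ 1 q t|
        + |((D t₀ 1 p t / p t) ^ 2 - D t₀ 2 p t / p t) / D t₀ 1 q t|
      < -(2 * (D t₀ 1 p t / p t)) := by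
  obtain ⟨c, hc, hp'⟩ := h.eventually_p'_le
  obtain ⟨C, hC, hp⟩ := h.isBigO_p.exists_pos
  have hsmall : (fun t => 2 * |D t₀ 2 q t / D t₀ 1 q t|
      + |((D t₀ 1 p t / p t) ^ 2 - D t₀ 2 p t / p t) / D t₀ 1 q t|) =o[atTop]
        fun t => t ^ (-1 : ℝ) :=
    (h.isBigO_contractionError.mono (le_principal_iff.2 (Ici_mem_atTop t₀))).trans_isLittleO
      (isLittleO_rpow_rpow_of_lt (by norm_num))
  filter_upwards [hp', hsmall.def (div_pos hc hC), eventually_ge_atTop t₀] with t hp't herr ht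
  have ht0 : 0 < t := h.t₀_pos.trans_le ht
  have hpt := h.p_pos t ht
  have hp_le : p t ≤ C * t ^ (-α) := by
    simpa [abs_of_pos hpt, abs_of_pos (Real.rpow_pos_of_pos ht0 _)] using
      isBigOWith_principal.1 hp t ht
  have hdecay : c / C * t ^ (-1 : ℝ) ≤ -(D t₀ 1 p t / p t) := by
    rw [← neg_div, le_div_iff₀ hpt]
    calc c / C * t ^ (-1 : ℝ) * p t ≤ c / C * t ^ (-1 : ℝ) * (C * t ^ (-α)) := by gcongr
      _ = c * t ^ (-α - 1) := by rw [sub_eq_add_neg, Real.rpow_add ht0]; field_simp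
      _ ≤ -D t₀ 1 p t := by linarith
  have hpos : 0 < c / C * t ^ (-1 : ℝ) := by positivity
  rw [Real.norm_of_nonneg (by positivity), Real.norm_of_nonneg (by positivity)] at herr
  linarith

theorem exists_strictMonoOn_amplitudeSq (h : AmplitudePhase t₀ α K p q) :
    ∃ T, t₀ ≤ T ∧ ∀ u v : ℝ, u ≠ 0 ∨ v ≠ 0 → StrictMonoOn (amplitudeSq t₀ p q u v) (Ici T) := by
  obtain ⟨T, hT⟩ := eventually_atTop.1
    (h.eventually_contractionError_lt.and (eventually_ge_atTop t₀))
  refine ⟨T, (hT T le_rfl).2, fun u v huv => ?_⟩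
  have hsub : Ici T ⊆ Ici t₀ := Ici_subset_Ici.2 (hT T le_rfl).2
  refine strictMonoOn_of_hasDerivWithinAt_pos (convex_Ici T)
    (fun t ht => (h.hasDerivWithinAt_amplitudeSq u v t (hsub ht)).continuousWithinAt.mono hsub)
    (fun t ht => (h.hasDerivWithinAt_amplitudeSq u v t (hsub (interior_subset ht))).mono
      (interior_subset.trans hsub)) fun t ht => ?_
  obtain ⟨herr, ht₀⟩ := hT t (interior_subset ht)
  have hpos := h.amplitudeSq_pos ht₀ huv
  generalize (D t₀ 1 p t / p t) ^ 2 - D t₀ 2 p t / p t = κ at herr ⊢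
  have hmain := mul_lt_mul_of_pos_right herr hpos
  set ξ := normalPos p u t
  set η := normalVel t₀ p q u v t
  have hG : amplitudeSq t₀ p q u v t = ξ ^ 2 + η ^ 2 := rfl
  rw [hG] at hmain ⊢
  have hdiag : D t₀ 2 q t / D t₀ 1 q t * η ^ 2
      ≤ |D t₀ 2 q t / D t₀ 1 q t| * (ξ ^ 2 + η ^ 2) := by
    gcongr
    · exact le_abs_self _
    · exact le_add_of_nonneg_left (sq_nonneg ξ)
  have hcross : -(κ / D t₀ 1 q t * (2 * (ξ * η))) ≤ |κ / D t₀ 1 q t| * (ξ ^ 2 + η ^ 2) := by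
    refine (neg_le_abs _).trans ?_
    rw [abs_mul]
    gcongr
    exact abs_le.2 ⟨by nlinarith [sq_nonneg (ξ + η)], by nlinarith [sq_nonneg (ξ - η)]⟩
  linarith

end AmplitudePhase

theorem IsPlanarSolution.ne_zero (hxy : IsPlanarSolution t₀ p q t₁ x y)
    (h : AmplitudePhase t₀ α K p q) (hne : ∃ t, t₁ ≤ t ∧ (x t ≠ 0 ∨ y t ≠ 0)) (t : ℝ)
    (ht : t₁ ≤ t) : x t ≠ 0 ∨ y t ≠ 0 := by
  obtain ⟨s, hs, hne⟩ := hne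
  by_contra! hzero
  have hpos := h.amplitudeSq_pos (hxy.le.trans hs) hne
  rw [hxy.amplitudeSq_eq h hs ht, hzero.1, hzero.2] at hpos
  simp [amplitudeSq, normalPos, normalVel] at hpos

/-- A fixed phase point carries a larger amplitude at a later time, whereas the amplitude of a
solution is constant. -/
theorem IsPlanarSolution.lt_one_of_eq_mul (hxy : IsPlanarSolution t₀ p q t₁ x y)
    (h : AmplitudePhase t₀ α K p q) {T s t l : ℝ}
    (hmono : ∀ u v : ℝ, u ≠ 0 ∨ v ≠ 0 → StrictMonoOn (amplitudeSq t₀ p q u v) (Ici T))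
    (hne : x s ≠ 0 ∨ y s ≠ 0) (hs : t₁ ≤ s) (hTs : T ≤ s) (hst : s < t) (hxl : x t = l * x s)
    (hyl : y t = l * y s) : l < 1 := by
  have hlt := hmono _ _ hne hTs (hTs.trans hst.le) hst
  rw [hxy.amplitudeSq_eq h hs (hs.trans hst.le), hxl, hyl, amplitudeSq_mul] at hlt
  have hpos := h.amplitudeSq_pos (hxy.le.trans (hs.trans hst.le)) hne
  by_contra! hl
  exact hlt.not_ge (le_mul_of_one_le_left hpos.le (one_le_pow₀ hl))

/-! ### Rotation of the phase portrait -/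

theorem AmplitudePhase.exists_angularVelocity_ge (h : AmplitudePhase t₀ α K p q) :
    ∃ m, 0 < m ∧ ∀ᶠ t in atTop, ∀ u v : ℝ, m * (u ^ 2 + v ^ 2) ≤
      v * v - u * (-restoringCoeff t₀ p q t * u + dampingCoeff t₀ p q t * v) := by
  have hK := h.K_pos
  have hm : 0 < min 1 (K ^ 2) / 2 := by positivity
  have hm₁ : min 1 (K ^ 2) / 2 ≤ 1 / 2 := by gcongr; exact min_le_left _ _
  have hmK : min 1 (K ^ 2) / 2 ≤ K ^ 2 / 2 := by gcongr; exact min_le_right _ _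
  set m := min 1 (K ^ 2) / 2
  have hb : 3 / 4 * K ^ 2 < K ^ 2 := by nlinarith [sq_pos_of_pos hK]
  refine ⟨m, hm, ?_⟩
  filter_upwards [h.tendsto_dampingCoeff.eventually (Ioo_mem_nhds (neg_lt_zero.2 hm) hm),
    h.tendsto_restoringCoeff.eventually (lt_mem_nhds hb)] with t ha hb u v
  have hcross : dampingCoeff t₀ p q t * (u * v) ≤ m / 2 * (u ^ 2 + v ^ 2) := by
    nlinarith [mul_nonneg (sub_nonneg.2 ha.1.le) (sq_nonneg (u - v)),
      mul_nonneg (sub_nonneg.2 ha.2.le) (sq_nonneg (u + v))]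
  nlinarith [mul_le_mul_of_nonneg_right hb.le (sq_nonneg u),
    mul_le_mul_of_nonneg_right hmK (sq_nonneg u), mul_le_mul_of_nonneg_right hm₁ (sq_nonneg v)]

theorem strictMonoOn_and_tendsto_of_hasDerivWithinAt_ge {a m : ℝ} {φ φ' : ℝ → ℝ}
    (hφ : ∀ t, a ≤ t → HasDerivWithinAt φ (φ' t) (Ici a) t) (hm : 0 < m)
    (hle : ∀ t, a ≤ t → m ≤ φ' t) : StrictMonoOn φ (Ici a) ∧ Tendsto φ atTop atTop := by
  have hcont : ContinuousOn φ (Ici a) := fun t ht => (hφ t ht).continuousWithinAt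
  have hderiv : ∀ t ∈ interior (Ici a), HasDerivAt φ (φ' t) t := fun t ht =>
    (hφ t (interior_subset ht)).hasDerivAt (mem_interior_iff_mem_nhds.1 ht)
  have hgrow := (convex_Ici a).mul_sub_le_image_sub_of_le_deriv hcont
    (fun t ht => (hderiv t ht).differentiableAt.differentiableWithinAt)
    (fun t ht => by rw [(hderiv t ht).deriv]; exact hle t (interior_subset ht))
  constructor
  · intro s hs t ht hst
    nlinarith [hgrow s hs t ht hst.le]
  · refine tendsto_atTop_mono' _ ?_ (tendsto_atTop_add_const_left _ (φ a)
      ((tendsto_id.atTop_add (tendsto_const_nhds (x := -a))).const_mul_atTop hm))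
    filter_upwards [eventually_ge_atTop a] with t ht
    simp only [id]
    linarith [hgrow a self_mem_Ici t ht ht]

theorem IsPlanarSolution.mono {t₂ : ℝ} (hxy : IsPlanarSolution t₀ p q t₁ x y) (ht : t₁ ≤ t₂) :
    IsPlanarSolution t₀ p q t₂ x y where
  le := hxy.le.trans ht
  x_deriv t ht' := (hxy.x_deriv t (ht.trans ht')).mono (Ici_subset_Ici.2 ht)
  y_deriv t ht' := (hxy.y_deriv t (ht.trans ht')).mono (Ici_subset_Ici.2 ht)

theorem IsPlanarSolution.tendsto_sqrt_sq_add_sq (hxy : IsPlanarSolution t₀ p q t₁ x y)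
    (h : AmplitudePhase t₀ α K p q) :
    Tendsto (fun t => Real.sqrt (x t ^ 2 + y t ^ 2)) atTop (𝓝 0) := by
  simpa using (((tendsto_zero_of_isBigO (hxy.isBigO_x h) h.α_pos).pow 2).add
    ((tendsto_zero_of_isBigO (hxy.isBigO_y h) h.α_pos).pow 2)).sqrt

theorem IsPlanarSolution.continuousOn_x (hxy : IsPlanarSolution t₀ p q t₁ x y) :
    ContinuousOn x (Ici t₁) := fun t ht => (hxy.x_deriv t ht).continuousWithinAt

theorem IsPlanarSolution.continuousOn_y (hxy : IsPlanarSolution t₀ p q t₁ x y) :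
    ContinuousOn y (Ici t₁) := fun t ht => (hxy.y_deriv t ht).continuousWithinAt

theorem AmplitudePhase.continuousOn_p (h : AmplitudePhase t₀ α K p q) : ContinuousOn p (Ici t₀) :=
  fun t ht => (h.hasDeriv_p t ht).continuousWithinAt

theorem AmplitudePhase.continuousOn_p' (h : AmplitudePhase t₀ α K p q) :
    ContinuousOn (D t₀ 1 p) (Ici t₀) := fun t ht => (h.hasDeriv_p' t ht).continuousWithinAt

theorem AmplitudePhase.continuousOn_q' (h : AmplitudePhase t₀ α K p q) :
    ContinuousOn (D t₀ 1 q) (Ici t₀) := fun t ht => (h.hasDeriv_q' t ht).continuousWithinAt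

theorem AmplitudePhase.continuousOn_dampingCoeff (h : AmplitudePhase t₀ α K p q) :
    ContinuousOn (dampingCoeff t₀ p q) (Ici t₀) := by
  exact ((h.continuousOn_p'.const_mul 2).div h.continuousOn_p fun t ht => (h.p_pos t ht).ne').add
    (h.continuousOn_q''.div h.continuousOn_q' fun t ht => (h.q'_pos t ht).ne')

theorem AmplitudePhase.continuousOn_restoringCoeff (h : AmplitudePhase t₀ α K p q) :
    ContinuousOn (restoringCoeff t₀ p q) (Ici t₀) := by
  have hp_ne : ∀ t ∈ Ici t₀, p t ≠ 0 := fun t ht => (h.p_pos t ht).ne'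
  have hq_ne : ∀ t ∈ Ici t₀, D t₀ 1 q t ≠ 0 := fun t ht => (h.q'_pos t ht).ne'
  exact (((h.continuousOn_q'.pow 2).add (((h.continuousOn_p'.pow 2).const_mul 2).div
    (h.continuousOn_p.pow 2) fun t ht => pow_ne_zero 2 (hp_ne t ht))).sub
      (h.continuousOn_p''.div h.continuousOn_p hp_ne)).add
    ((h.continuousOn_p'.mul h.continuousOn_q'').div (h.continuousOn_p.mul h.continuousOn_q')
      fun t ht => mul_ne_zero (hp_ne t ht) (hq_ne t ht))

theorem IsPlanarSolution.continuousOn_y_deriv (hxy : IsPlanarSolution t₀ p q t₁ x y)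
    (h : AmplitudePhase t₀ α K p q) :
    ContinuousOn (fun t => -restoringCoeff t₀ p q t * x t + dampingCoeff t₀ p q t * y t)
      (Ici t₁) := by
  have hsub : Ici t₁ ⊆ Ici t₀ := Ici_subset_Ici.2 hxy.le
  exact ((h.continuousOn_restoringCoeff.mono hsub).neg.mul hxy.continuousOn_x).add
    ((h.continuousOn_dampingCoeff.mono hsub).mul hxy.continuousOn_y)

theorem IsPlanarSolution.exists_isSpiral (hxy : IsPlanarSolution t₀ p q t₁ x y)
    (h : AmplitudePhase t₀ α K p q) (hne : ∃ t, t₁ ≤ t ∧ (x t ≠ 0 ∨ y t ≠ 0)) :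
    ∃ t₂, t₁ ≤ t₂ ∧ IsSpiral ((fun t => !₂[x t, y t]) '' Ici t₂) := by
  obtain ⟨m, hm, hvel⟩ := h.exists_angularVelocity_ge
  obtain ⟨T, -, hmono⟩ := h.exists_strictMonoOn_amplitudeSq
  obtain ⟨t₂, ht₂⟩ := eventually_atTop.1
    (hvel.and ((eventually_ge_atTop t₁).and (eventually_ge_atTop T)))
  have ht₁₂ : t₁ ≤ t₂ := (ht₂ t₂ le_rfl).2.1
  have hxy₂ := hxy.mono ht₁₂
  have hne₂ : ∀ t, t₂ ≤ t → x t ≠ 0 ∨ y t ≠ 0 := fun t ht => hxy.ne_zero h hne t (ht₁₂.trans ht)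
  obtain ⟨R, φ, hφ₀, hR, hpolar, hφ⟩ := exists_clockwise_angle hxy₂.x_deriv hxy₂.y_deriv
    hxy₂.continuousOn_y (hxy₂.continuousOn_y_deriv h) hne₂
  have hRsq : ∀ t, t₂ ≤ t → R t = Real.sqrt (x t ^ 2 + y t ^ 2) := fun t ht => by
    rw [(hpolar t ht).1, (hpolar t ht).2, neg_sq, mul_pow, mul_pow, ← mul_add,
      Real.cos_sq_add_sin_sq, mul_one, Real.sqrt_sq (hR t).le]
  obtain ⟨hφ_mono, hφ_top⟩ := strictMonoOn_and_tendsto_of_hasDerivWithinAt_ge hφ hm fun t ht => by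
    have hpos : 0 < x t ^ 2 + y t ^ 2 := by
      rcases hne₂ t ht with hx | hy <;> positivity
    exact (le_div_iff₀ hpos).2 ((ht₂ t ht).1 _ _)
  refine ⟨t₂, ht₁₂, ?_⟩
  rw [image_congr fun t ht => by rw [(hpolar t ht).1, (hpolar t ht).2]]
  refine isSpiral_of_clockwise_angle hφ₀ (fun t ht => (hφ t ht).continuousWithinAt) hφ_mono hφ_top
    hR ((hxy.tendsto_sqrt_sq_add_sq h).congr' ?_) fun s t hs hst hturn => ?_
  · filter_upwards [eventually_ge_atTop t₂] with t ht using (hRsq t ht).symm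
  · refine (div_lt_one (hR s)).1 (hxy.lt_one_of_eq_mul h hmono (hne₂ s hs) (ht₁₂.trans hs)
      (ht₂ s hs).2.2 hst ?_ ?_)
    · rw [(hpolar t (hs.trans hst.le)).1, (hpolar s hs).1, hturn, Real.cos_add_two_pi]
      field_simp [(hR s).ne']
    · rw [(hpolar t (hs.trans hst.le)).2, (hpolar s hs).2, hturn, Real.sin_add_two_pi]
      field_simp [(hR s).ne']

end

/-! ### Box dimension of phase portraits and of trajectories -/

theorem lipschitzWith_coord {N : ℕ} (i : Fin N) :
    LipschitzWith 1 fun v : EuclideanSpace ℝ (Fin N) => v i :=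
  (LipschitzWith.eval i).comp (PiLp.lipschitzWith_ofLp 2 _) |>.weaken (by simp)

theorem lipschitzWith_coord_pair {N : ℕ} (i j : Fin N) :
    LipschitzWith 1 fun v : EuclideanSpace ℝ (Fin N) => (v i, v j) := by
  simpa using (lipschitzWith_coord i).prodMk (lipschitzWith_coord j)

theorem IsPowerLipschitzModAngle.congr_mono {X : Type*} [PseudoMetricSpace X] {t₀ t₁ α m : ℝ}
    {ang : ℝ → ℝ} {f g : ℝ → X} (hf : IsPowerLipschitzModAngle t₀ α m ang f) (ht₁ : t₀ ≤ t₁)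
    (hgf : EqOn g f (Ici t₁)) : IsPowerLipschitzModAngle t₁ α m ang g := by
  obtain ⟨C, hC, hf⟩ := hf
  refine ⟨C, hC, fun T s t hT hs ht => ?_⟩
  rw [hgf (hT.trans hs), hgf (hT.trans ht)]
  exact hf T s t (ht₁.trans hT) hs ht

section

variable {t₀ α K t₁ γ Z m : ℝ} {p q x y : ℝ → ℝ}

theorem isPowerLipschitz_const_mul_rpow_neg {β : ℝ} (ht₁ : 0 < t₁) (hβ : β ≠ 0) (hβγ : -γ ≤ β)
    (Z : ℝ) : IsPowerLipschitz t₁ β fun t => Z * t ^ (-γ) :=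
  (isPowerLipschitz_of_hasDerivWithinAt ht₁ hβ
    (fun _ ht => (Real.hasDerivAt_rpow_const (Or.inl (ht₁.trans_le ht).ne')).hasDerivWithinAt)
    ((isBigO_rpow_rpow_of_le ht₁ (by linarith)).const_mul_left (-γ))).const_mul Z

theorem isPowerLipschitz_spaceCurve {β : ℝ} {z : ℝ → ℝ} (hx : IsPowerLipschitz t₁ β x)
    (hy : IsPowerLipschitz t₁ β y) (hz : IsPowerLipschitz t₁ β z) :
    IsPowerLipschitz t₁ β (spaceCurve x y z) :=
  isPowerLipschitz_of_apply fun i => by fin_cases i <;> assumption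

theorem isPowerLipschitzModAngle_spaceCurve {ang z : ℝ → ℝ}
    (hx : IsPowerLipschitzModAngle t₁ α m ang x) (hy : IsPowerLipschitzModAngle t₁ α m ang y)
    (hz : IsPowerLipschitzModAngle t₁ α m ang z) :
    IsPowerLipschitzModAngle t₁ α m ang (spaceCurve x y z) :=
  isPowerLipschitzModAngle_of_apply fun i => by fin_cases i <;> assumption

namespace IsPlanarSolution

theorem hasBoxDim (hxy : IsPlanarSolution t₀ p q t₁ x y) (h : AmplitudePhase t₀ α K p q)
    (hne : ∃ t, t₁ ≤ t ∧ (x t ≠ 0 ∨ y t ≠ 0)) (hα : α < 1) :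
    HasBoxDim ((fun t => !₂[x t, y t]) '' Ici t₁) (2 / (1 + α)) := by
  obtain ⟨A, θ, hA, hx, hy⟩ := hxy.exists_pos_eqOn_sol h hne
  have hα₀ := h.α_pos
  have hβ : 1 - α ≠ 0 := by linarith
  have hhead : IsPowerLipschitz t₁ (1 - α) fun t => !₂[x t, y t] :=
    isPowerLipschitz_of_apply fun i => by
      fin_cases i
      exacts [hxy.isPowerLipschitz_x h hβ le_rfl, hxy.isPowerLipschitz_y h hβ le_rfl]
  have htail : IsPowerLipschitzModAngle t₁ α α (reducedPhase q θ) fun t => !₂[x t, y t] :=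
    isPowerLipschitzModAngle_of_apply fun i => by
      fin_cases i
      exacts [(h.isPowerLipschitzModAngle_solPos hα₀ le_rfl A θ).congr_mono hxy.le hx,
        (h.isPowerLipschitzModAngle_solVel hα₀ le_rfl A θ).congr_mono hxy.le hy]
  convert hasBoxDim_of_isPowerLipschitz_of_hasDenseRegions hhead htail (h.t₀_pos.trans_le hxy.le)
    hα₀ hα (reducedPhase_mem_Icc q θ) (lipschitzWith_coord_pair 0 1) ?_ using 1
  · field_simp
    ring
  · rw [image_image]
    convert h.hasDenseRegions_solPos_solVel hxy.le hA θ using 1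
    exact image_congr fun t ht => Prod.ext (hx ht) (hy ht)

theorem isPowerLipschitz_spaceCurve_head (hxy : IsPlanarSolution t₀ p q t₁ x y)
    (h : AmplitudePhase t₀ α K p q) (hα : α < 1) (hγ : 0 < γ) (Z : ℝ) :
    IsPowerLipschitz t₁ (1 - α) (spaceCurve x y fun t => Z * t ^ (-γ)) :=
  have hβ : 1 - α ≠ 0 := by linarith
  isPowerLipschitz_spaceCurve (hxy.isPowerLipschitz_x h hβ le_rfl)
    (hxy.isPowerLipschitz_y h hβ le_rfl)
    (isPowerLipschitz_const_mul_rpow_neg (h.t₀_pos.trans_le hxy.le) hβ (by linarith) Z)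

theorem exists_isPowerLipschitzModAngle_spaceCurve (hxy : IsPlanarSolution t₀ p q t₁ x y)
    (h : AmplitudePhase t₀ α K p q) (hne : ∃ t, t₁ ≤ t ∧ (x t ≠ 0 ∨ y t ≠ 0)) (hm : 0 < m)
    (hmα : m ≤ α) (hmγ : m ≤ γ) (Z : ℝ) : ∃ A θ : ℝ, 0 < A ∧
      EqOn x (solPos p q A θ) (Ici t₁) ∧ EqOn y (solVel t₀ p q A θ) (Ici t₁) ∧
      IsPowerLipschitzModAngle t₁ α m (reducedPhase q θ)
        (spaceCurve x y fun t => Z * t ^ (-γ)) := by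
  obtain ⟨A, θ, hA, hx, hy⟩ := hxy.exists_pos_eqOn_sol h hne
  have ht₁ : 0 < t₁ := h.t₀_pos.trans_le hxy.le
  exact ⟨A, θ, hA, hx, hy, isPowerLipschitzModAngle_spaceCurve
    ((h.isPowerLipschitzModAngle_solPos hm hmα A θ).congr_mono hxy.le hx)
    ((h.isPowerLipschitzModAngle_solVel hm hmα A θ).congr_mono hxy.le hy)
    ((isPowerLipschitz_const_mul_rpow_neg ht₁ (neg_ne_zero.2 hm.ne')
      (neg_le_neg hmγ) Z).modAngle ht₁ α _)⟩

theorem hasBoxDim_spaceCurve_of_le (hxy : IsPlanarSolution t₀ p q t₁ x y)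
    (h : AmplitudePhase t₀ α K p q) (hne : ∃ t, t₁ ≤ t ∧ (x t ≠ 0 ∨ y t ≠ 0)) (hα : α < 1)
    (hαγ : α ≤ γ) (Z : ℝ) :
    HasBoxDim ((spaceCurve x y fun t => Z * t ^ (-γ)) '' Ici t₁) (2 / (1 + α)) := by
  have hα₀ := h.α_pos
  obtain ⟨A, θ, hA, hx, hy, htail⟩ :=
    hxy.exists_isPowerLipschitzModAngle_spaceCurve h hne hα₀ le_rfl hαγ Z
  convert hasBoxDim_of_isPowerLipschitz_of_hasDenseRegions
    (hxy.isPowerLipschitz_spaceCurve_head h hα (hα₀.trans_le hαγ) Z) htail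
    (h.t₀_pos.trans_le hxy.le) hα₀ hα (reducedPhase_mem_Icc q θ) (lipschitzWith_coord_pair 0 1) ?_
    using 1
  · field_simp
    ring
  · rw [image_image]
    convert h.hasDenseRegions_solPos_solVel hxy.le hA θ using 1
    exact image_congr fun t ht => Prod.ext (hx ht) (hy ht)

theorem hasBoxDim_spaceCurve_of_lt (hxy : IsPlanarSolution t₀ p q t₁ x y)
    (h : AmplitudePhase t₀ α K p q) (hne : ∃ t, t₁ ≤ t ∧ (x t ≠ 0 ∨ y t ≠ 0)) (hα : α < 1)
    (hγ : 0 < γ) (hγα : γ < α) (hZ : 0 < Z) :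
    HasBoxDim ((spaceCurve x y fun t => Z * t ^ (-γ)) '' Ici t₁) (2 - (α + γ) / (1 + γ)) := by
  obtain ⟨A, θ, hA, hx, -, htail⟩ :=
    hxy.exists_isPowerLipschitzModAngle_spaceCurve h hne hγ hγα.le le_rfl Z
  refine hasBoxDim_of_isPowerLipschitz_of_hasDenseRegions
    (hxy.isPowerLipschitz_spaceCurve_head h hα hγ Z) htail (h.t₀_pos.trans_le hxy.le) hγ hα
    (reducedPhase_mem_Icc q θ) (lipschitzWith_coord_pair 0 2) ?_
  rw [image_image]
  convert h.hasDenseRegions_solPos_rpow hxy.le hA θ hZ hγ hγα.le using 1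
  exact image_congr fun t ht => Prod.ext (hx ht) rfl

theorem exists_isPowerLipschitz_spaceCurve (hxy : IsPlanarSolution t₀ p q t₁ x y)
    (h : AmplitudePhase t₀ α K p q) (hα : 1 < α) (hγ : 0 < γ) (Z : ℝ) :
    ∃ μ, 0 < μ ∧ IsPowerLipschitz t₁ (-μ) (spaceCurve x y fun t => Z * t ^ (-γ)) := by
  have hμ : 0 < min (α - 1) γ := lt_min (sub_pos.2 hα) hγ
  have hβ := neg_ne_zero.2 hμ.ne'
  have hβα : 1 - α ≤ -min (α - 1) γ := by linarith [min_le_left (α - 1) γ]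
  exact ⟨_, hμ, isPowerLipschitz_spaceCurve (hxy.isPowerLipschitz_x h hβ hβα)
    (hxy.isPowerLipschitz_y h hβ hβα) (isPowerLipschitz_const_mul_rpow_neg
      (h.t₀_pos.trans_le hxy.le) hβ (neg_le_neg (min_le_right _ _)) Z)⟩

theorem isRectifiable_spaceCurve (hxy : IsPlanarSolution t₀ p q t₁ x y)
    (h : AmplitudePhase t₀ α K p q) (hα : 1 < α) (hγ : 0 < γ) (Z : ℝ) :
    IsRectifiable (spaceCurve x y fun t => Z * t ^ (-γ)) t₁ := by
  obtain ⟨μ, hμ, hlip⟩ := hxy.exists_isPowerLipschitz_spaceCurve h hα hγ Z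
  exact hlip.isRectifiable (h.t₀_pos.trans_le hxy.le) hμ

theorem hasBoxDim_one_spaceCurve (hxy : IsPlanarSolution t₀ p q t₁ x y)
    (h : AmplitudePhase t₀ α K p q) (hα : 1 < α) (hγ : 0 < γ) (hZ : 0 < Z) :
    HasBoxDim ((spaceCurve x y fun t => Z * t ^ (-γ)) '' Ici t₁) 1 := by
  have ht₁ : 0 < t₁ := h.t₀_pos.trans_le hxy.le
  obtain ⟨μ, hμ, hlip⟩ := hxy.exists_isPowerLipschitz_spaceCurve h hα hγ Z
  refine hlip.hasBoxDim_one ht₁ hμ (lipschitzWith_coord 2) (η := Z * t₁ ^ (-γ)) (by positivity) ?_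
  rw [image_image]
  have hlim : Tendsto (fun t : ℝ => Z * t ^ (-γ)) atTop (𝓝 0) := by
    simpa using (tendsto_rpow_neg_atTop hγ).const_mul Z
  exact isPreconnected_Ici.intermediate_value_Ioc self_mem_Ici
    (le_principal_iff.2 (Ici_mem_atTop t₁)) ((continuousOn_rpow_Ici ht₁ (-γ)).const_mul Z) hlim

end IsPlanarSolution

theorem IsSolution.isPlanarSolution (hx : IsSolution t₀ p q x) :
    IsPlanarSolution t₀ p q t₀ x (D t₀ 1 x) where
  le := le_rfl
  x_deriv := by simpa only [D_zero] using hasDerivWithinAt_D hx.1 two_pos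
  y_deriv t ht := by
    convert! hasDerivWithinAt_D hx.1 one_lt_two t ht using 1
    linarith [hx.2 t ht]

end

theorem hasDerivWithinAt_comp_sub_const {f : ℝ → ℝ} {f' a σ t : ℝ}
    (hf : HasDerivWithinAt f f' (Ici a) (t - σ)) :
    HasDerivWithinAt (fun t => f (t - σ)) f' (Ici (a + σ)) t := by
  convert! hf.scomp t ((hasDerivWithinAt_id t (Ici (a + σ))).sub_const σ)
    fun _ hu => le_sub_iff_add_le.2 hu using 1
  exact (one_smul ℝ f').symm

namespace IsSystemSolution

variable {t₀ α K γ s₀ : ℝ} {p q x y z : ℝ → ℝ}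

theorem exists_shift (h : IsSystemSolution t₀ γ p q s₀ x y z) (hγ : 0 < γ) :
    ∃ σ, ∀ s, s₀ ≤ s → γ * z s ^ (-1 / γ) = s + σ := by
  have hderiv : ∀ s, s₀ ≤ s →
      HasDerivWithinAt (fun s => γ * z s ^ (-1 / γ) - s) 0 (Ici s₀) s := fun s hs => by
    have hz := h.z_pos s hs
    have hexp : z s ^ ((γ + 1) / γ) * z s ^ (-1 / γ - 1) = 1 := by
      rw [← Real.rpow_add hz, show (γ + 1) / γ + (-1 / γ - 1) = 0 by field_simp; ring,
        Real.rpow_zero]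
    convert! (((h.z_deriv s hs).rpow_const (p := -1 / γ) (Or.inl hz.ne')).const_mul γ).sub
      (hasDerivWithinAt_id s (Ici s₀)) using 1
    linear_combination
      z s ^ ((γ + 1) / γ) * z s ^ (-1 / γ - 1) * mul_div_cancel₀ (-1) hγ.ne' - hexp
  refine ⟨γ * z s₀ ^ (-1 / γ) - s₀, fun s hs => ?_⟩
  have hconst := norm_sub_le_of_norm_deriv_le hderiv (B := 0) (B' := 0)
    (fun t _ => hasDerivWithinAt_const t _ 0) (fun t _ => norm_zero.le) le_rfl hs
  rw [Pi.zero_apply, Pi.zero_apply, sub_zero, norm_le_zero_iff] at hconst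
  linarith

theorem le_time (h : IsSystemSolution t₀ γ p q s₀ x y z) (ht₀ : 0 < t₀) (hγ : 0 < γ) {s : ℝ}
    (hs : s₀ ≤ s) : t₀ ≤ γ * z s ^ (-1 / γ) := by
  have hγt : 0 < γ / t₀ := by positivity
  calc t₀ = γ * ((γ / t₀) ^ γ) ^ (-1 / γ) := by
        rw [← Real.rpow_mul hγt.le, mul_div_cancel₀ _ hγ.ne', Real.rpow_neg_one, inv_div,
          mul_div_cancel₀ _ hγ.ne']
    _ ≤ γ * z s ^ (-1 / γ) := by
        gcongr γ * ?_
        exact Real.rpow_le_rpow_of_nonpos (h.z_pos s hs) (h.z_le s hs)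
          (div_nonpos_of_nonpos_of_nonneg (by norm_num) hγ.le)

theorem eq_rpow_time (h : IsSystemSolution t₀ γ p q s₀ x y z) (hγ : 0 < γ) {s : ℝ} (hs : s₀ ≤ s) :
    z s = γ ^ γ * (γ * z s ^ (-1 / γ)) ^ (-γ) := by
  have hz := h.z_pos s hs
  rw [Real.mul_rpow hγ.le (by positivity), ← Real.rpow_mul hz.le,
    show -1 / γ * -γ = 1 by field_simp, Real.rpow_one, ← mul_assoc, ← Real.rpow_add hγ,
    add_neg_cancel, Real.rpow_zero, one_mul]

theorem exists_isPlanarSolution (h : IsSystemSolution t₀ γ p q s₀ x y z) (ht₀ : 0 < t₀)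
    (hγ : 0 < γ) : ∃ σ,
      IsPlanarSolution t₀ p q (s₀ + σ) (fun t => x (t - σ)) (fun t => y (t - σ)) ∧
      EqOn (spaceCurve x y z)
        (spaceCurve (fun t => x (t - σ)) (fun t => y (t - σ)) (fun t => γ ^ γ * t ^ (-γ)) ∘ (· + σ))
        (Ici s₀) := by
  obtain ⟨σ, hσ⟩ := h.exists_shift hγ
  refine ⟨σ, ⟨hσ s₀ le_rfl ▸ h.le_time ht₀ hγ le_rfl, fun t ht => ?_, fun t ht => ?_⟩,
    fun s hs => ?_⟩
  · exact hasDerivWithinAt_comp_sub_const (h.x_deriv _ (le_sub_iff_add_le.2 ht))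
  · have ht' : s₀ ≤ t - σ := le_sub_iff_add_le.2 ht
    have hy := h.y_deriv _ ht'
    rw [U, V, hσ _ ht', sub_add_cancel] at hy
    exact hasDerivWithinAt_comp_sub_const hy
  · have hz : z s = γ ^ γ * (s + σ) ^ (-γ) := hσ s hs ▸ h.eq_rpow_time hγ hs
    simp only [Function.comp_apply, spaceCurve, add_sub_cancel_right, hz]

theorem exists_image_eq (h : IsSystemSolution t₀ γ p q s₀ x y z) (ht₀ : 0 < t₀) (hγ : 0 < γ)
    (hne : ∃ s, s₀ ≤ s ∧ (x s ≠ 0 ∨ y s ≠ 0)) : ∃ t₁ u v, IsPlanarSolution t₀ p q t₁ u v ∧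
      (∃ t, t₁ ≤ t ∧ (u t ≠ 0 ∨ v t ≠ 0)) ∧
      spaceCurve x y z '' Ici s₀ = (spaceCurve u v fun t => γ ^ γ * t ^ (-γ)) '' Ici t₁ := by
  obtain ⟨σ, huv, hcurve⟩ := h.exists_isPlanarSolution ht₀ hγ
  obtain ⟨s, hs, hxy⟩ := hne
  refine ⟨s₀ + σ, _, _, huv, ⟨s + σ, by gcongr, by simpa only [add_sub_cancel_right] using hxy⟩, ?_⟩
  rw [hcurve.image_eq, image_comp, image_add_const_Ici]

theorem hasBoxDim_of_le (hsys : IsSystemSolution t₀ γ p q s₀ x y z)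
    (h : AmplitudePhase t₀ α K p q) (hne : ∃ s, s₀ ≤ s ∧ (x s ≠ 0 ∨ y s ≠ 0)) (hα : α < 1)
    (hαγ : α ≤ γ) : HasBoxDim (spaceCurve x y z '' Ici s₀) (2 / (1 + α)) := by
  obtain ⟨t₁, u, v, huv, hne, himage⟩ :=
    hsys.exists_image_eq h.t₀_pos (h.α_pos.trans_le hαγ) hne
  exact himage ▸ huv.hasBoxDim_spaceCurve_of_le h hne hα hαγ _

theorem hasBoxDim_of_lt (hsys : IsSystemSolution t₀ γ p q s₀ x y z)
    (h : AmplitudePhase t₀ α K p q) (hne : ∃ s, s₀ ≤ s ∧ (x s ≠ 0 ∨ y s ≠ 0)) (hα : α < 1)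
    (hγ : 0 < γ) (hγα : γ < α) :
    HasBoxDim (spaceCurve x y z '' Ici s₀) (2 - (α + γ) / (1 + γ)) := by
  obtain ⟨t₁, u, v, huv, hne, himage⟩ := hsys.exists_image_eq h.t₀_pos hγ hne
  exact himage ▸ huv.hasBoxDim_spaceCurve_of_lt h hne hα hγ hγα (by positivity)

theorem isRectifiable (hsys : IsSystemSolution t₀ γ p q s₀ x y z)
    (h : AmplitudePhase t₀ α K p q) (hα : 1 < α) (hγ : 0 < γ) :
    IsRectifiable (spaceCurve x y z) s₀ := by
  obtain ⟨σ, huv, hcurve⟩ := hsys.exists_isPlanarSolution h.t₀_pos hγ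
  rw [IsRectifiable, eVariationOn.congr hcurve,
    eVariationOn.comp_eq_of_monotoneOn _ _ ((add_left_mono).monotoneOn _), image_add_const_Ici]
  exact huv.isRectifiable_spaceCurve h hα hγ _

theorem hasBoxDim_one (hsys : IsSystemSolution t₀ γ p q s₀ x y z)
    (h : AmplitudePhase t₀ α K p q) (hα : 1 < α) (hγ : 0 < γ) :
    HasBoxDim (spaceCurve x y z '' Ici s₀) 1 := by
  obtain ⟨σ, huv, hcurve⟩ := hsys.exists_isPlanarSolution h.t₀_pos hγ
  rw [hcurve.image_eq, image_comp, image_add_const_Ici]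
  exact huv.hasBoxDim_one_spaceCurve h hα hγ (by positivity)

end IsSystemSolution

end SpiralTraj

end

theorem theorem1_general (t₀ α K : ℝ) (p q : ℝ → ℝ)
    (ht₀ : 0 < t₀) (hα : 0 < α) (hK : 0 < K)
    (hq_smooth : ContDiffOn ℝ 2 q (Set.Ici t₀))
    (hp_ne : ∀ t, t₀ ≤ t → p t ≠ 0)
    (hq_ne : ∀ t, t₀ ≤ t → SpiralTraj.D t₀ 1 q t ≠ 0)
    (hp : SpiralTraj.ComparableInLimit t₀ 2 1 α p)
    (hq : Tendsto (SpiralTraj.D t₀ 1 q) atTop (𝓝 K))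
    (hq2 : SpiralTraj.D t₀ 2 q =O[atTop] fun t : ℝ => t ^ (-2 : ℝ)) :
    (∀ x : ℝ → ℝ, SpiralTraj.IsSolution t₀ p q x → (∃ t, t₀ ≤ t ∧ x t ≠ 0) →
      (∃ t₁, t₀ ≤ t₁ ∧ SpiralTraj.IsSpiral (SpiralTraj.phaseCurve t₀ x '' Set.Ici t₁)) ∧
      (α < 1 →
        SpiralTraj.HasBoxDim (SpiralTraj.phaseCurve t₀ x '' Set.Ici t₀) (2 / (1 + α)))) ∧
    (∀ (γ : ℝ), 0 < γ → ∀ (s₀ : ℝ) (x y z : ℝ → ℝ),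
      SpiralTraj.IsSystemSolution t₀ γ p q s₀ x y z →
      (∃ s, s₀ ≤ s ∧ (x s ≠ 0 ∨ y s ≠ 0)) →
      (α < 1 → α ≤ γ →
        SpiralTraj.HasBoxDim (SpiralTraj.spaceCurve x y z '' Set.Ici s₀) (2 / (1 + α))) ∧
      (α < 1 → γ < α →
        SpiralTraj.HasBoxDim (SpiralTraj.spaceCurve x y z '' Set.Ici s₀)
          (2 - (α + γ) / (1 + γ)))) ∧
    (∀ (γ : ℝ), 0 < γ → ∀ (s₀ : ℝ) (x y z : ℝ → ℝ),
      SpiralTraj.IsSystemSolution t₀ γ p q s₀ x y z → 1 < α →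
      SpiralTraj.IsRectifiable (SpiralTraj.spaceCurve x y z) s₀ ∧
      SpiralTraj.HasBoxDim (SpiralTraj.spaceCurve x y z '' Set.Ici s₀) 1) := by
  have h := SpiralTraj.amplitudePhase_of_comparableInLimit ht₀ hα hK hq_smooth hp_ne hq_ne hp hq hq2
  refine ⟨fun x hx hne => ?_, fun γ hγ s₀ x y z hsys hne => ?_, fun γ hγ s₀ x y z hsys hα1 => ?_⟩
  · obtain ⟨t, ht, hxt⟩ := hne
    have hne : ∃ t, t₀ ≤ t ∧ (x t ≠ 0 ∨ SpiralTraj.D t₀ 1 x t ≠ 0) := ⟨t, ht, Or.inl hxt⟩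
    exact ⟨hx.isPlanarSolution.exists_isSpiral h hne, hx.isPlanarSolution.hasBoxDim h hne⟩
  · exact ⟨fun hα1 => hsys.hasBoxDim_of_le h hne hα1,
      fun hα1 => hsys.hasBoxDim_of_lt h hne hα1 hγ⟩
  · exact ⟨hsys.isRectifiable h hα1 hγ, hsys.hasBoxDim_one h hα1 hγ⟩

theorem theorem1 (t₀ α K : ℝ) (p q : ℝ → ℝ)
    (ht₀ : 0 < t₀) (hα : 0 < α) (hK : 0 < K)
    (hp_smooth : ContDiffOn ℝ 3 p (Set.Ici t₀))
    (hq_smooth : ContDiffOn ℝ 3 q (Set.Ici t₀))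
    (hp_ne : ∀ t, t₀ ≤ t → p t ≠ 0)
    (hq_ne : ∀ t, t₀ ≤ t → SpiralTraj.D t₀ 1 q t ≠ 0)
    (hp : SpiralTraj.ComparableInLimit t₀ 2 1 α p)
    (hp3 : SpiralTraj.D t₀ 3 p =O[Filter.atTop] fun t : ℝ => t ^ (-α - 3))
    (hq : SpiralTraj.ComparableInLimit t₀ 1 K (-1) q)
    (hq2 : SpiralTraj.D t₀ 2 q =o[Filter.atTop] fun t : ℝ => t ^ (-3 : ℝ))
    (hq3 : SpiralTraj.D t₀ 3 q =o[Filter.atTop] fun t : ℝ => t ^ (-2 : ℝ)) :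
    -- phase portraits and phase dimension
    (∀ x : ℝ → ℝ, SpiralTraj.IsSolution t₀ p q x → (∃ t, t₀ ≤ t ∧ x t ≠ 0) →
      (∃ t₁, t₀ ≤ t₁ ∧ SpiralTraj.IsSpiral (SpiralTraj.phaseCurve t₀ x '' Set.Ici t₁)) ∧
      (α < 1 →
        SpiralTraj.HasBoxDim (SpiralTraj.phaseCurve t₀ x '' Set.Ici t₀) (2 / (1 + α)))) ∧
    -- trajectories of the spatial system, nonrectifiable cases
    (∀ (γ : ℝ), 0 < γ → ∀ (s₀ : ℝ) (x y z : ℝ → ℝ),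
      SpiralTraj.IsSystemSolution t₀ γ p q s₀ x y z →
      (∃ s, s₀ ≤ s ∧ (x s ≠ 0 ∨ y s ≠ 0)) →
      (α < 1 → α ≤ γ →
        SpiralTraj.HasBoxDim (SpiralTraj.spaceCurve x y z '' Set.Ici s₀) (2 / (1 + α))) ∧
      (α < 1 → γ < α →
        SpiralTraj.HasBoxDim (SpiralTraj.spaceCurve x y z '' Set.Ici s₀)
          (2 - (α + γ) / (1 + γ)))) ∧
    -- trajectories of the spatial system, rectifiable case
    (∀ (γ : ℝ), 0 < γ → ∀ (s₀ : ℝ) (x y z : ℝ → ℝ),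
      SpiralTraj.IsSystemSolution t₀ γ p q s₀ x y z → 1 < α →
      SpiralTraj.IsRectifiable (SpiralTraj.spaceCurve x y z) s₀ ∧
      SpiralTraj.HasBoxDim (SpiralTraj.spaceCurve x y z '' Set.Ici s₀) 1) := by
  exact theorem1_general t₀ α K p q ht₀ hα hK (hq_smooth.of_le (by norm_num)) hp_ne hq_ne hp
    (hq.tendsto_deriv le_rfl)
    (hq2.isBigO.trans (SpiralTraj.isLittleO_rpow_rpow_of_lt (by norm_num)).isBigO)
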